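/- Let $K$ be a non-archimedean local field of characteristic $p>0$, with normalized absolute value $|\cdot|$, ring of integers $\mathfrak D=\{|x|\le 1\}$, maximal ideal $\mathfrak B=\{|x|<1\}$, a fixed prime element $\mathfrak p$ (an element of maximal absolute value in $\mathfrak B$), residue field of order $q=p^c$, and Haar measure $\mu=dx$ on $K^+$ with $\mu(\mathfrak D)=1$. Let $1=\epsilon_0,\epsilon_1,\dots,\epsilon_{c-1}\in K$ be elements whose $GF(p)$-linear span is a subfield of $K$ with $q$ elements. Let $\chi$ be the continuous unitary character of $K^+$ with $\chi(\epsilon_0\mathfrak p^{-1})=e^{2\pi i/p}$ and $\chi(\epsilon_k\mathfrak p^{-j})=1$ for $0\le k<c$, $j\in\mathbb Z$ with $k\neq0$ or $j\ne1$. For $0\le n<q$, $n=\sum_{k=0}^{c-1}a_kp^k$ with $0\le a_k<p$, put $u(n)=\big(\sum_k a_k\epsilon_k\big)\mathfrak p^{-1}$; for $n=\sum_k b_kq^k$ with $0\le b_k<q$, put $u(n)=\sum_k\mathfrak p^{-k}u(b_k)$. The Fourier transform on $L^2(K)$ is the continuous extension from $L^1(K)\cap L^2(K)$ of $\hat f(\xi)=\int_K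 f(x)\chi(-\xi x)\,dx$. For $f\in L^2(K)$, $j\in\mathbb Z$, $t\in\mathbb N_0$ put $f_{j,t}(x)=q^{j/2}f(\mathfrak p^{-j}x-u(t))$. Functions $f^{(1)},\dots,f^{(L)}\in L^2(K)$ generate a Parseval multiframelet if $\sum_{l=1}^L\sum_{j\in\mathbb Z}\sum_{t\in\mathbb N_0}|\langle g,f^{(l)}_{j,t}\rangle|^2=\|g\|^2$ for all $g\in L^2(K)$. A set $\mathcal P\subset K$ is a Parseval multiframelet set of order $L$, with pieces $W_1,\dots,W_L$, if $\mathcal P=\bigcup_{m=1}^L W_m$ with $W_m$ measurable and there are $\psi^{(1)},\dots,\psi^{(L)}\in L^2(K)$ generating a Parseval multiframelet with $\widehat{\psi^{(m)}}=\mathbf 1_{W_m}$ (a.e.) for all $m$. Theorem. Let $W_1,\dots,W_L\subset K$ and $\mathcal P=\bigcup_{m=1}^L W_m$. Then $\mathcal P$ is a Parseval multiframelet set of order $L$ with pieces $W_1,\dots,W_L$ if and only if (a) $\{\mathfrak p^jW_m : j\in\mathbb Z,\ 1\le m\le L\}$ is a measurable partition of $K$ a.e.: every $\mathfrak p^jW_m$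 is measurable, $\mu(\mathfrak p^jW_m\cap\mathfrak p^{j'}W_{m'})=0$ whenever $(j,m)\ne(j',m')$, and the complement of $\bigcup_{j,m}\mathfrak p^jW_m$ is a null set; and (b) for all $1\le m\le L$, all $j\in\mathbb N_0$ and all $t\in\mathbb N_0\setminus q\mathbb N_0$, $\mathfrak p^jW_m\cap(\mathfrak p^jW_m+u(t))=\emptyset$ up to a set of measure zero. Consequently, a set $\mathcal P\subset K$ is a Parseval multiframelet set of order $L$ (with some choice of pieces) if and only if it can be written as $\mathcal P=\bigcup_{m=1}^L W_m$ with sets $W_m$ satisfying (a) and (b). -/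

import Mathlib

open MeasureTheory Filter Topology ValuativeRel

namespace LocalFieldFramelet

noncomputable section

variable {K : Type*} [Field K]

/-- `ϖ` is an element of maximal valuation in `{x | |x| < 1}`, i.e. a prime element of `K`. -/
def IsPrimeElement [ValuativeRel K] (ϖ : K) : Prop :=
  valuation K ϖ < 1 ∧ ∀ x : K, valuation K x < 1 → valuation K x ≤ valuation K ϖ

/-- `1 = ε₀, ε₁, …, ε_{c-1}` are elements of `K` whose `GF(p)`-linear span (in characteristic `p`,
the additive subgroup generated by them) is a subfield of `K` with `p ^ c` elements. -/
def IsConstantBasis (p c : ℕ) [NeZero c] (ε : Fin c → K) : Prop :=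
  ε 0 = 1 ∧ ∃ k : Subfield K,
    Nat.card k = p ^ c ∧ (k : Set K) = AddSubgroup.closure (Set.range ε)

/-- The continuous unitary character `χ` of `K⁺` with `χ(ε₀ ϖ⁻¹) = exp (2πi/p)`, and
`χ(ε_k ϖ^{-j}) = 1` whenever `k ≠ 0` or `j ≠ 1`. -/
def IsStandardCharacter [TopologicalSpace K] (p : ℕ) {c : ℕ} [NeZero c] (ϖ : K) (ε : Fin c → K)
    (χ : AddChar K Circle) : Prop :=
  Continuous χ ∧ ∀ (k : Fin c) (j : ℤ),
    χ (ε k * ϖ ^ (-j)) = if k = 0 ∧ j = 1 then Circle.exp (2 * Real.pi / p) else 1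

/-- For `b = ∑ a_k p^k` with `0 ≤ a_k < p` and `0 ≤ k < c`, the element `(∑ a_k ε_k) ϖ⁻¹`. -/
def uDigit (p : ℕ) {c : ℕ} (ϖ : K) (ε : Fin c → K) (b : ℕ) : K :=
  (∑ k : Fin c, ((b / p ^ (k : ℕ) % p : ℕ) : K) * ε k) * ϖ⁻¹

/-- The translation `u(n) = ∑ ϖ^{-k} u(b_k)`, where `n = ∑ b_k q^k` with `0 ≤ b_k < q = p ^ c`.
All base-`q` digits of `n` beyond position `n` vanish. -/
def u (p : ℕ) {c : ℕ} (ϖ : K) (ε : Fin c → K) (n : ℕ) : K :=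
  ∑ k ∈ Finset.range (n + 1), ϖ ^ (-(k : ℤ)) * uDigit p ϖ ε (n / (p ^ c) ^ k % p ^ c)

/-- The affine system: `f_{j,t}(x) = q^{j/2} f(ϖ^{-j} x - u(t))`, where `q = p ^ c`. -/
def affine (p : ℕ) {c : ℕ} (ϖ : K) (ε : Fin c → K) (f : K → ℂ) (j : ℤ) (t : ℕ) (x : K) : ℂ :=
  (((p ^ c : ℕ) : ℝ) ^ ((j : ℝ) / 2) : ℝ) * f (ϖ ^ (-j) * x - u p ϖ ε t)

/-- The inner product `⟨f, g⟩ = ∫ f(x) conj(g(x)) dx`. -/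
def inner₂ [MeasurableSpace K] (μ : Measure K) (f g : K → ℂ) : ℂ :=
  ∫ x, f x * (starRingEnd ℂ) (g x) ∂μ

/-- `F` is (a representative of) the Fourier transform of `f ∈ L²(K)`: the extension to `L²(K)`, by
continuity, of `h ↦ (ξ ↦ ∫ h(x) χ(-xξ) dx)` on `L¹(K) ∩ L²(K)`. -/
def IsFourierTransform [MeasurableSpace K] (μ : Measure K) (χ : AddChar K Circle)
    (f F : K → ℂ) : Prop :=
  MemLp f 2 μ ∧ MemLp F 2 μ ∧ ∃ h : ℕ → K → ℂ,
    (∀ n, MemLp (h n) 1 μ ∧ MemLp (h n) 2 μ) ∧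
    Tendsto (fun n => eLpNorm (h n - f) 2 μ) atTop (𝓝 0) ∧
    Tendsto (fun n => eLpNorm (Fourier.fourierIntegral χ μ (h n) - F) 2 μ) atTop (𝓝 0)

/-- The affine system generated by `f⁽¹⁾, …, f⁽ᴸ⁾ ∈ L²(K)` has frame bounds `A` and `B`:
`A ‖g‖² ≤ ∑_{l,j,t} |⟨g, f⁽ˡ⁾_{j,t}⟩|² ≤ B ‖g‖²` for all `g ∈ L²(K)`. -/
def IsMultiframeletWithBounds [MeasurableSpace K] (μ : Measure K) (p : ℕ) {c : ℕ} (ϖ : K)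
    (ε : Fin c → K) {L : ℕ} (f : Fin L → K → ℂ) (A B : ℝ) : Prop :=
  (∀ l, MemLp (f l) 2 μ) ∧ ∀ g : K → ℂ, MemLp g 2 μ → ∃ S : ℝ,
    HasSum (fun i : Fin L × ℤ × ℕ => ‖inner₂ μ g (affine p ϖ ε (f i.1) i.2.1 i.2.2)‖ ^ 2) S ∧
    A * ∫ x, ‖g x‖ ^ 2 ∂μ ≤ S ∧ S ≤ B * ∫ x, ‖g x‖ ^ 2 ∂μ

/-- The affine system generated by `f⁽¹⁾, …, f⁽ᴸ⁾` is a Parseval multiframelet for `L²(K)`. -/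
def IsParsevalMultiframelet [MeasurableSpace K] (μ : Measure K) (p : ℕ) {c : ℕ} (ϖ : K)
    (ε : Fin c → K) {L : ℕ} (f : Fin L → K → ℂ) : Prop :=
  IsMultiframeletWithBounds μ p ϖ ε f 1 1

/-- The pieces `W₁, …, W_L` are measurable, and `1_{W₁}, …, 1_{W_L}` are the Fourier transforms of
functions generating a Parseval multiframelet. -/
def GeneratesParseval [MeasurableSpace K] (μ : Measure K) (χ : AddChar K Circle) (p : ℕ)
    {c : ℕ} (ϖ : K) (ε : Fin c → K) {L : ℕ} (W : Fin L → Set K) : Prop :=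
  (∀ m, MeasurableSet (W m)) ∧ ∃ f : Fin L → K → ℂ,
    (∀ m, IsFourierTransform μ χ (f m) ((W m).indicator 1)) ∧
    IsParsevalMultiframelet μ p ϖ ε f

/-- `P` is a Parseval multiframelet set of order `L`. -/
def IsParsevalMultiframeletSet [MeasurableSpace K] (μ : Measure K) (χ : AddChar K Circle) (p : ℕ)
    {c : ℕ} (ϖ : K) (ε : Fin c → K) (L : ℕ) (P : Set K) : Prop :=
  ∃ W : Fin L → Set K, P = ⋃ m, W m ∧ GeneratesParseval μ χ p ϖ ε W

/-- The set `ϖ^j S`. -/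
def dilate (ϖ : K) (j : ℤ) (S : Set K) : Set K := (fun x => ϖ ^ j * x) '' S

/-- The set `S + a`. -/
def translate (S : Set K) (a : K) : Set K := (fun x => x + a) '' S

/-- A family of sets is a measurable partition of `K` up to null sets. -/
def IsAEPartition [MeasurableSpace K] {ι : Type*} (μ : Measure K) (S : ι → Set K) : Prop :=
  (∀ i, MeasurableSet (S i)) ∧ (∀ i i', i ≠ i' → μ (S i ∩ S i') = 0) ∧ μ (⋃ i, S i)ᶜ = 0

/-- The dilates `ϖ^j W_m`, over all integers `j` and all `m`, form an a.e. measurable partition. -/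
def DilatesPartition [MeasurableSpace K] (μ : Measure K) (ϖ : K) {L : ℕ}
    (W : Fin L → Set K) : Prop :=
  IsAEPartition μ (fun i : ℤ × Fin L => dilate ϖ i.1 (W i.2))

/-- `ϖ^j W_m ∩ (ϖ^j W_m + u(t))` is empty up to a null set for all `m`, all `j ≥ 0` and all
`t ≥ 0` which are not multiples of `q = p ^ c`. -/
def TranslatesDisjoint [MeasurableSpace K] (μ : Measure K) (p : ℕ) {c : ℕ} (ϖ : K)
    (ε : Fin c → K) {L : ℕ} (W : Fin L → Set K) : Prop :=
  ∀ (m : Fin L) (j t : ℕ), ¬ p ^ c ∣ t →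
    μ (dilate ϖ j (W m) ∩ translate (dilate ϖ j (W m)) (u p ϖ ε t)) = 0

end

end LocalFieldFramelet

/-!
The proof moves everything to the Fourier side, where the statement becomes elementary.

Write `𝔇` for the ring of integers and `Λ = {u(t)}`. The digits of `t` run through representatives
of the residue field, so `Λ` is a discrete subgroup with `K = Λ ⊕ 𝔇`, and `χ` is trivial on `𝔇`, on
all products of two elements of `Λ`, but not at `ϖ⁻¹`
(`IsConstantBasis.isDualLattice`, `IsConstantBasis.isNormalizedPair`).

Integrating the transform of `h` over the ball `ϖ⁻ⁿ 𝔇` gives the averages of `h` over translates of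
the dual ball `ϖⁿ 𝔇`, and these converge to `h` in `L²`. This yields Plancherel's identity on
`L¹ ∩ L²` (`IsNormalizedPair.eLpNorm_fourierIntegral`), the Fourier transform of every function in
`L²`, Parseval's identity, and the fact that every function in `L¹ ∩ L²` is a Fourier transform.
Applied to functions supported in `𝔇`, whose transforms are constant on cosets of `𝔇`, Plancherel
says that the characters `χ (u(t) ·)` are a complete orthonormal system on `𝔇`.

Since `u(qʲ t) = ϖ⁻ʲ u(t)`, condition (b) says that each piece `W` packs: its translates by distinct
elements of `Λ` overlap in null sets only (`translatesDisjoint_iff`). For such `W`, a function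
supported in `W` has the same norm and the same coefficients against `χ (u(t) ·)` as its
periodization on `𝔇`. Hence, if `ψ` has transform `1_W`, the coefficients of `g` against `ψ_{j,t}`,
`t ≥ 0`, carry exactly the energy of `ĝ` on `ϖ⁻ʲ W` (`IsDualLattice.tsum_enorm_sq_inner₂`). Summing
over `j` and the pieces, the Parseval condition is the statement that the dilates of the pieces
partition `K`, which is (a).

It remains to see that the pieces of a Parseval multiframelet pack. If `W` meets a translate of
itself in positive measure, there is `A ⊆ W` whose periodization `h` takes the value `2` on a set of
positive measure, so `∫ h² > ∫ h = μ(A)`; this contradicts the frame inequality for the function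
with transform `1_A` (`IsDualLattice.packs_of_bessel`).
-/

namespace LocalFieldFramelet

/-! ### Balls, digits and translations -/

section Balls

variable {K : Type*} [Field K] [ValuativeRel K]

/-- The fractional ideal `ϖ ^ n 𝔇` of `K`, described by the valuation. -/
def ball (ϖ : K) (n : ℤ) : AddSubgroup K where
  carrier := {x | valuation K x ≤ valuation K ϖ ^ n}
  zero_mem' := by simp
  add_mem' {x y} hx hy := by
    rw [Set.mem_ofPred_eq] at *
    exact Valuation.map_add_le _ hx hy
  neg_mem' {x} hx := by simpa using hx

lemma coe_ball (ϖ : K) (n : ℤ) :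
    (ball ϖ n : Set K) = {x | valuation K x ≤ valuation K ϖ ^ n} := rfl

lemma mem_ball {ϖ : K} {n : ℤ} {x : K} :
    x ∈ ball ϖ n ↔ valuation K x ≤ valuation K ϖ ^ n := by
  rw [← SetLike.mem_coe, coe_ball, Set.mem_ofPred_eq]

lemma mem_ball_zero {ϖ x : K} : x ∈ ball ϖ 0 ↔ valuation K x ≤ 1 := by simp [mem_ball]

lemma zpow_mul_mem_ball {ϖ : K} (h0 : ϖ ≠ 0) {m n : ℤ} {x : K} :
    ϖ ^ m * x ∈ ball ϖ n ↔ x ∈ ball ϖ (n - m) := by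
  have hv : valuation K ϖ ≠ 0 := by simpa using h0
  rw [mem_ball, mem_ball, map_mul, map_zpow₀, zpow_sub₀ hv, le_div_iff₀ (by
    exact zero_lt_iff.mpr (zpow_ne_zero _ hv)), mul_comm]

lemma mul_mem_ball {ϖ : K} (h0 : ϖ ≠ 0) {m n : ℤ} {x y : K} (hx : x ∈ ball ϖ m)
    (hy : y ∈ ball ϖ n) : x * y ∈ ball ϖ (m + n) := by
  have hv : valuation K ϖ ≠ 0 := by simpa using h0
  rw [mem_ball, map_mul, zpow_add₀ hv]
  exact mul_le_mul' (mem_ball.1 hx) (mem_ball.1 hy)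

lemma ball_anti {ϖ : K} (h0 : ϖ ≠ 0) (h1 : valuation K ϖ < 1) {m n : ℤ} (h : m ≤ n) :
    ball ϖ n ≤ ball ϖ m := fun x hx =>
  mem_ball.2 <| le_trans (mem_ball.1 hx)
    (zpow_le_zpow_right_of_le_one₀ (zero_lt_iff.mpr (by simpa using h0)) h1.le h)

lemma IsPrimeElement.mem_ball_one {ϖ : K} (hϖ : IsPrimeElement ϖ) {x : K} :
    x ∈ ball ϖ 1 ↔ valuation K x < 1 := by
  rw [mem_ball, zpow_one]
  exact ⟨fun h => h.trans_lt hϖ.1, hϖ.2 x⟩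

end Balls

section Topology

variable {K : Type*} [Field K] [ValuativeRel K] [TopologicalSpace K]
  [IsNonarchimedeanLocalField K] {ϖ : K}

lemma IsPrimeElement.ne_zero (hϖ : IsPrimeElement ϖ) : ϖ ≠ 0 := by
  rintro rfl
  obtain ⟨x, hx, hx1⟩ := Valuation.IsNontrivial.exists_lt_one (v := valuation K)
  have := hϖ.2 x hx1
  simp at this hx
  exact hx this

lemma exists_valuation_pow_le (hϖ : IsPrimeElement ϖ) {γ : ValueGroupWithZero K} (hγ : γ ≠ 0) :
    ∃ n : ℕ, valuation K ϖ ^ n ≤ γ := by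
  have hv : valuation K ϖ ≠ 0 := by simpa using hϖ.ne_zero
  have := ValuativeRel.isRankLeOne_iff_mulArchimedean.mp
    (inferInstance : ValuativeRel.IsRankLeOne K)
  obtain ⟨n, hn⟩ := MulArchimedean.arch γ⁻¹ (one_lt_inv₀ (zero_lt_iff.mpr hv) |>.mpr hϖ.1)
  refine ⟨n, ?_⟩
  rw [inv_pow] at hn
  exact (inv_le_inv₀ (zero_lt_iff.mpr hγ) (zero_lt_iff.mpr (pow_ne_zero _ hv))).mp hn

lemma exists_mem_ball_neg (hϖ : IsPrimeElement ϖ) (x : K) : ∃ n : ℕ, x ∈ ball ϖ (-n : ℤ) := by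
  have hv : valuation K ϖ ≠ 0 := by simpa using hϖ.ne_zero
  by_cases hx : x = 0
  · exact ⟨0, hx ▸ zero_mem _⟩
  have hx' : valuation K x ≠ 0 := by simpa using hx
  obtain ⟨n, hn⟩ := exists_valuation_pow_le hϖ (inv_ne_zero hx')
  refine ⟨n, ?_⟩
  rw [mem_ball, zpow_neg, zpow_natCast]
  rwa [le_inv_comm₀ (zero_lt_iff.mpr hx') (zero_lt_iff.mpr (pow_ne_zero _ hv))]

lemma isOpen_ball (hϖ : IsPrimeElement ϖ) (n : ℤ) : IsOpen (ball ϖ n : Set K) := by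
  have hv : valuation K ϖ ≠ 0 := by simpa using hϖ.ne_zero
  refine AddSubgroup.isOpen_of_mem_nhds _ (g := 0) ?_
  rw [(IsValuativeTopology.hasBasis_nhds_zero' K).mem_iff]
  exact ⟨valuation K ϖ ^ n, zpow_ne_zero _ hv, fun x hx => mem_ball.2 (le_of_lt hx)⟩

lemma isCompact_ball (n : ℤ) : IsCompact (ball ϖ n : Set K) :=
  coe_ball ϖ n ▸ IsNonarchimedeanLocalField.isCompact_closedBall K _

lemma hasBasis_ball (hϖ : IsPrimeElement ϖ) :
    (𝓝 (0 : K)).HasBasis (fun _ : ℕ => True) (fun n => (ball ϖ (n : ℤ) : Set K)) := by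
  have hv : valuation K ϖ ≠ 0 := by simpa using hϖ.ne_zero
  refine ⟨fun s => ⟨fun hs => ?_, fun ⟨n, _, hn⟩ =>
    mem_of_superset ((isOpen_ball hϖ n).mem_nhds (zero_mem _)) hn⟩⟩
  obtain ⟨γ, hγ, hs⟩ := (IsValuativeTopology.hasBasis_nhds_zero' K).mem_iff.mp hs
  obtain ⟨n, hn⟩ := exists_valuation_pow_le hϖ hγ
  refine ⟨n + 1, trivial, fun x hx => hs ?_⟩
  have hx : valuation K x ≤ valuation K ϖ ^ ((n + 1 : ℕ) : ℤ) := mem_ball.1 hx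
  rw [zpow_natCast, pow_succ] at hx
  exact (hx.trans_lt (mul_lt_of_lt_one_right (zero_lt_iff.mpr (pow_ne_zero _ hv)) hϖ.1)).trans_le hn

lemma IsPrimeElement.t2Space (hϖ : IsPrimeElement ϖ) : T2Space K := by
  refine IsTopologicalAddGroup.t2Space_of_zero_sep fun x hx => ?_
  have hx' : valuation K x ≠ 0 := by simpa using hx
  have hv : valuation K ϖ ≠ 0 := by simpa using hϖ.ne_zero
  obtain ⟨n, hn⟩ := exists_valuation_pow_le hϖ hx'
  refine ⟨ball ϖ (n + 1 : ℕ), (isOpen_ball hϖ _).mem_nhds (zero_mem _), fun h => ?_⟩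
  have h := mem_ball.1 h
  rw [zpow_natCast, pow_succ] at h
  exact ((h.trans_lt
    (mul_lt_of_lt_one_right (zero_lt_iff.mpr (pow_ne_zero _ hv)) hϖ.1)).trans_le hn).false

lemma IsPrimeElement.secondCountableTopology (hϖ : IsPrimeElement ϖ) :
    SecondCountableTopology K := by
  let := IsTopologicalAddGroup.rightUniformSpace K
  have := isUniformAddGroup_of_addCommGroup (G := K)
  have : (𝓝 (0 : K)).IsCountablyGenerated := (hasBasis_ball hϖ).isCountablyGenerated
  have := IsUniformAddGroup.uniformity_countably_generated (α := K)
  let := UniformSpace.pseudoMetricSpace K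
  have : SigmaCompactSpace K :=
    ⟨⟨fun n : ℕ => (ball ϖ (-n : ℤ) : Set K), fun n => isCompact_ball _,
      Set.eq_univ_of_forall fun x => Set.mem_iUnion.2 (exists_mem_ball_neg hϖ x)⟩⟩
  exact EMetric.secondCountable_of_sigmaCompact K

end Topology

section Digits

variable {K : Type*} [Field K] [ValuativeRel K] {ϖ : K}

lemma valuation_eq_one_of_mem_finite_subfield (k : Subfield K) [Finite k] {x : K} (hx : x ∈ k)
    (h0 : x ≠ 0) : valuation K x = 1 := by
  have := Fintype.ofFinite k
  have h1 : (⟨x, hx⟩ : k) ^ (Fintype.card k - 1) = 1 :=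
    FiniteField.pow_card_sub_one_eq_one _ (by simpa [Subtype.ext_iff] using h0)
  have h2 : x ^ (Fintype.card k - 1) = 1 := congrArg Subtype.val h1
  have h3 : valuation K x ^ (Fintype.card k - 1) = 1 := by rw [← map_pow, h2, map_one]
  have := Fintype.one_lt_card (α := k)
  exact (pow_eq_one_iff.1 h3).resolve_right (by omega)

/-- A subfield with as many elements as the residue field is a system of representatives of the
residue field. -/
lemma exists_sub_mem_ball_one [TopologicalSpace K] [IsNonarchimedeanLocalField K]
    (hϖ : IsPrimeElement ϖ) (k : Subfield K) [Finite k]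
    (hk : Nat.card (IsLocalRing.ResidueField (valuation K).integer) = Nat.card k)
    {x : K} (hx : x ∈ ball ϖ 0) : ∃ e ∈ k, x - e ∈ ball ϖ 1 := by
  have hle : ∀ e : k, (e : K) ∈ (valuation K).integer := fun e => by
    by_cases h : (e : K) = 0
    · rw [h]; exact zero_mem _
    · exact (valuation_eq_one_of_mem_finite_subfield k e.2 h).le
  let f : k →+* (valuation K).integer := RingHom.codRestrict k.subtype _ hle
  let g := (IsLocalRing.residue (valuation K).integer).comp f
  have hfin : Finite (IsLocalRing.ResidueField (valuation K).integer) :=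
    Nat.finite_of_card_ne_zero (hk ▸ Nat.card_pos.ne')
  have hg : Function.Bijective g := g.injective.bijective_of_nat_card_le hk.le
  obtain ⟨e, he⟩ := hg.2 (IsLocalRing.residue _ ⟨x, mem_ball_zero.1 hx⟩)
  refine ⟨e, e.2, hϖ.mem_ball_one.2 ?_⟩
  have h1 : IsLocalRing.residue (valuation K).integer (⟨x, mem_ball_zero.1 hx⟩ - f e) = 0 := by
    rw [map_sub, ← he]; exact sub_self _
  rw [IsLocalRing.residue_eq_zero_iff, IsLocalRing.mem_maximalIdeal, mem_nonunits_iff,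
    (Valuation.integer.integers (valuation K)).isUnit_iff_valuation_eq_one] at h1
  exact lt_of_le_of_ne (Valuation.mem_integer_iff _ _ |>.1 (⟨x, mem_ball_zero.1 hx⟩ - f e).2) h1

lemma mem_ball_zero_of_mem_subfield (k : Subfield K) [Finite k] {x : K} (hx : x ∈ k) :
    x ∈ ball ϖ 0 := by
  by_cases h : x = 0
  · rw [h]; exact zero_mem _
  · exact mem_ball_zero.2 (valuation_eq_one_of_mem_finite_subfield k hx h).le

lemma eq_zero_of_mem_subfield_of_mem_ball_one (hϖ : IsPrimeElement ϖ) (k : Subfield K) [Finite k]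
    {x : K} (hx : x ∈ k) (h : x ∈ ball ϖ 1) : x = 0 := by
  by_contra h0
  rw [hϖ.mem_ball_one, valuation_eq_one_of_mem_finite_subfield k hx h0] at h
  exact lt_irrefl _ h

end Digits

section Translations

variable {K : Type*} [Field K] {p c : ℕ} {ϖ : K} {ε : Fin c → K}

/-- The constant `∑ a_k ε_k` with the base-`p` digits `a_k` of `b`. -/
def digit (p : ℕ) {c : ℕ} (ε : Fin c → K) (b : ℕ) : K :=
  ∑ k : Fin c, ((b / p ^ (k : ℕ) % p : ℕ) : K) * ε k

lemma uDigit_eq (b : ℕ) : uDigit p ϖ ε b = digit p ε b * ϖ⁻¹ := rfl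

@[simp] lemma digit_zero : digit p ε 0 = 0 := by simp [digit]

/-- All digits beyond position `n` vanish, so the defining sum may be taken over a longer range. -/
lemma u_eq_sum (hq : 1 < p ^ c) {n N : ℕ} (h : n + 1 ≤ N) : u p ϖ ε n =
    ∑ k ∈ Finset.range N, ϖ ^ (-(k : ℤ)) * uDigit p ϖ ε (n / (p ^ c) ^ k % p ^ c) := by
  refine Finset.sum_subset (by simpa using h) fun k _ hk => ?_
  have hk : n ≤ k := by simp at hk; omega
  rw [Nat.div_eq_of_lt (hk.trans_lt (Nat.lt_pow_self hq)), Nat.zero_mod, uDigit_eq, digit_zero]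
  simp

lemma u_zero : u p ϖ ε 0 = 0 := by simp [u, uDigit_eq]

/-- The recursion for `u` that prepends a base-`q` digit. -/
lemma u_add_mul (h0 : ϖ ≠ 0) (hq : 1 < p ^ c) {b : ℕ} (hb : b < p ^ c) (n : ℕ) :
    u p ϖ ε (b + p ^ c * n) = ϖ⁻¹ * (digit p ε b + u p ϖ ε n) := by
  have hn : n ≤ p ^ c * n := Nat.le_mul_of_pos_left _ (by omega)
  rw [u_eq_sum hq (N := b + p ^ c * n + 2) (by omega),
    u_eq_sum hq (n := n) (N := b + p ^ c * n + 1) (by omega), Finset.sum_range_succ', mul_add,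
    Finset.mul_sum, add_comm]
  congr 1
  · simp [Nat.mod_eq_of_lt hb, uDigit_eq, mul_comm]
  · refine Finset.sum_congr rfl fun k _ => ?_
    have : (b + p ^ c * n) / (p ^ c) ^ (k + 1) = n / (p ^ c) ^ k := by
      rw [pow_succ', ← Nat.div_div_eq_div_mul, Nat.add_mul_div_left _ _ (by omega),
        Nat.div_eq_of_lt hb, zero_add]
    rw [this, ← mul_assoc]
    congr 1
    rw [Nat.cast_succ, neg_add, zpow_add₀ h0, zpow_neg_one, mul_comm]

lemma u_pow_mul (h0 : ϖ ≠ 0) (hq : 1 < p ^ c) (j n : ℕ) :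
    u p ϖ ε ((p ^ c) ^ j * n) = ϖ ^ (-(j : ℤ)) * u p ϖ ε n := by
  induction j with
  | zero => simp
  | succ j ih =>
    have := u_add_mul (ε := ε) h0 hq (b := 0) (by omega) ((p ^ c) ^ j * n)
    rw [zero_add, digit_zero, zero_add, ← mul_assoc, ← pow_succ', ih, ← mul_assoc] at this
    rw [this, Nat.cast_succ, neg_add, zpow_add₀ h0, zpow_neg_one, mul_comm (ϖ⁻¹)]

/-- Induction on the base-`q` expansion of a natural number. -/
lemma base_induction {q : ℕ} (hq : 1 < q) {P : ℕ → Prop} (zero : P 0)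
    (step : ∀ b < q, ∀ n, P n → P (b + q * n)) (n : ℕ) : P n := by
  induction n using Nat.strong_induction_on with
  | _ n ih =>
    rcases Nat.eq_zero_or_pos n with rfl | hn
    · exact zero
    · rw [← Nat.mod_add_div n q]
      exact step _ (Nat.mod_lt _ (by omega)) _ (ih _ (Nat.div_lt_self hn hq))

lemma digit_mem {k : Subfield K} (hkε : (k : Set K) = AddSubgroup.closure (Set.range ε)) (b : ℕ) :
    digit p ε b ∈ k := by
  refine sum_mem fun i _ => mul_mem (natCast_mem _ _) ?_
  have : ε i ∈ (AddSubgroup.closure (Set.range ε) : Set K) :=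
    AddSubgroup.subset_closure ⟨i, rfl⟩
  rwa [← hkε] at this

end Translations

section Constants

variable {K : Type*} [Field K] {p c : ℕ} [Fact p.Prime] {ϖ : K} {ε : Fin c → K}

lemma one_lt_pow_card [NeZero c] : 1 < p ^ c :=
  Nat.one_lt_pow (NeZero.ne c) (Fact.out : p.Prime).one_lt

variable {k : Subfield K}

/-- Every element of the span of the `ε_k` is given by a digit, because `p ε_k = 0`. -/
lemma exists_digit_eq [CharP K p] (hkε : (k : Set K) = AddSubgroup.closure (Set.range ε)) {e : K}
    (hek : e ∈ k) : ∃ b < p ^ c, digit p ε b = e := by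
  have hp : 0 < p := (Fact.out : p.Prime).pos
  have he : e ∈ AddSubgroup.closure (Set.range ε) := by
    have he : e ∈ (k : Set K) := hek
    rwa [hkε] at he
  have hform : ∀ e ∈ AddSubgroup.closure (Set.range ε),
      ∃ a : Fin c → ℤ, ∑ i, (a i : K) * ε i = e := by
    intro e he
    induction he using AddSubgroup.closure_induction with
    | mem x hx =>
      obtain ⟨i, rfl⟩ := hx
      exact ⟨Pi.single i 1, by simp [Pi.single_apply]⟩
    | zero => exact ⟨0, by simp⟩
    | add x y _ _ hx hy =>
      obtain ⟨a, rfl⟩ := hx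
      obtain ⟨b, rfl⟩ := hy
      exact ⟨a + b, by simp [add_mul, Finset.sum_add_distrib]⟩
    | neg x _ hx =>
      obtain ⟨a, rfl⟩ := hx
      exact ⟨-a, by simp⟩
  obtain ⟨a, rfl⟩ := hform e he
  have hlt : ∀ i, (a i % p).toNat < p := fun i => by
    have h1 := Int.emod_nonneg (a i) (by exact_mod_cast hp.ne' : (p : ℤ) ≠ 0)
    have h2 := Int.emod_lt_of_pos (a i) (by exact_mod_cast hp : (0 : ℤ) < p)
    omega
  let d : Fin c → Fin p := fun i => ⟨(a i % p).toNat, hlt i⟩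
  refine ⟨finFunctionFinEquiv d, (finFunctionFinEquiv d).2, ?_⟩
  refine Finset.sum_congr rfl fun i _ => ?_
  congr 1
  have h1 : ((finFunctionFinEquiv d : ℕ) / p ^ (i : ℕ) % p) = (d i : ℕ) := by
    conv_rhs => rw [← finFunctionFinEquiv.symm_apply_apply d]
    rw [finFunctionFinEquiv_symm_apply_val]
  rw [h1]
  have h2 : (((d i : ℕ) : ℤ) : K) = (a i : K) := by
    rw [CharP.intCast_eq_intCast K p]
    have h1 := Int.emod_nonneg (a i) (by exact_mod_cast hp.ne' : (p : ℤ) ≠ 0)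
    simp only [d, Int.toNat_of_nonneg h1]
    exact Int.mod_modEq _ _
  exact_mod_cast h2

lemma digit_injOn [CharP K p] (hk : Nat.card k = p ^ c)
    (hkε : (k : Set K) = AddSubgroup.closure (Set.range ε)) {b b' : ℕ} (hb : b < p ^ c)
    (hb' : b' < p ^ c) (h : digit p ε b = digit p ε b') : b = b' := by
  let f : Fin (p ^ c) → k := fun b => ⟨digit p ε b, digit_mem hkε b⟩
  have hf : Function.Surjective f := fun e => by
    obtain ⟨b, hb, h⟩ := exists_digit_eq (p := p) hkε e.2
    exact ⟨⟨b, hb⟩, Subtype.ext h⟩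
  have : Finite k := Finite.of_surjective f hf
  have hinj := (hf.bijective_of_nat_card_le (by simp [hk])).1
  exact congrArg Fin.val (@hinj ⟨b, hb⟩ ⟨b', hb'⟩ (Subtype.ext h))

end Constants

/-! ### The lattice of translations and the character -/

section

variable {K : Type*} [Field K] {p c : ℕ} [NeZero c] {ϖ : K} {ε : Fin c → K} {k : Subfield K}

/-- `χ` is trivial at all monomials with exponent other than `-1`. -/
lemma IsStandardCharacter.apply_mul_zpow [TopologicalSpace K] {χ : AddChar K Circle}
    (hχ : IsStandardCharacter p ϖ ε χ)
    (hkε : (k : Set K) = AddSubgroup.closure (Set.range ε)) {e : K} (hek : e ∈ k) {j : ℤ}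
    (hj : j ≠ -1) : χ (e * ϖ ^ j) = 1 := by
  have he : e ∈ AddSubgroup.closure (Set.range ε) := by
    have he : e ∈ (k : Set K) := hek
    rwa [hkε] at he
  clear hek
  induction he using AddSubgroup.closure_induction with
  | mem x hx =>
    obtain ⟨i, rfl⟩ := hx
    have := hχ.2 i (-j)
    rwa [neg_neg, if_neg (by rintro ⟨_, h⟩; omega)] at this
  | zero => simp
  | add x y _ _ hx hy => rw [add_mul, AddChar.map_add_eq_mul, hx, hy, one_mul]
  | neg x _ hx => rw [neg_mul, AddChar.map_neg_eq_inv, hx, inv_one]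

lemma exists_u_sub_eq [Fact p.Prime] [CharP K p] (h0 : ϖ ≠ 0)
    (hkε : (k : Set K) = AddSubgroup.closure (Set.range ε)) (m n : ℕ) :
    ∃ l, u p ϖ ε m - u p ϖ ε n = u p ϖ ε l := by
  have hq : 1 < p ^ c := one_lt_pow_card
  induction hN : m + n using Nat.strong_induction_on generalizing m n with
  | _ N ih =>
    rcases Nat.eq_zero_or_pos N with h | h
    · obtain ⟨rfl, rfl⟩ : m = 0 ∧ n = 0 := by omega
      exact ⟨0, by simp [u_zero]⟩
    · have hlt : m / p ^ c + n / p ^ c < N := by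
        have h1 := Nat.div_le_self m (p ^ c)
        have h2 := Nat.div_le_self n (p ^ c)
        rcases Nat.eq_zero_or_pos m with hm | hm
        · have := Nat.div_lt_self (n := n) (by omega) hq
          omega
        · have := Nat.div_lt_self hm hq
          omega
      obtain ⟨l, hl⟩ := ih _ hlt _ _ rfl
      obtain ⟨b, hb, hbe⟩ := exists_digit_eq (p := p) hkε
        (sub_mem (digit_mem (p := p) hkε (m % p ^ c)) (digit_mem (p := p) hkε (n % p ^ c)))
      refine ⟨b + p ^ c * l, ?_⟩
      have hm := u_add_mul (ε := ε) h0 hq (Nat.mod_lt m (by omega : p ^ c > 0)) (m / p ^ c)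
      have hn := u_add_mul (ε := ε) h0 hq (Nat.mod_lt n (by omega : p ^ c > 0)) (n / p ^ c)
      rw [Nat.mod_add_div] at hm hn
      rw [u_add_mul h0 hq hb, hm, hn, hbe, ← hl]
      ring

lemma IsStandardCharacter.char_inv [Fact p.Prime] [TopologicalSpace K] {χ : AddChar K Circle}
    (hχ : IsStandardCharacter p ϖ ε χ)
    (hε : ε 0 = 1) : χ ϖ⁻¹ ≠ 1 := by
  have h := hχ.2 0 1
  rw [hε, one_mul, zpow_neg_one, if_pos ⟨rfl, rfl⟩] at h
  rw [h]
  intro h1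
  have hp : (1 : ℝ) < p := by exact_mod_cast (Fact.out : p.Prime).one_lt
  obtain ⟨n, hn⟩ := Circle.exp_eq_one.1 h1
  have hpi := Real.two_pi_pos
  have h2 : (1 : ℝ) = n * p := by
    field_simp at hn
    linarith
  have h3 : (1 : ℤ) = n * p := by exact_mod_cast h2
  have h4 : (p : ℤ) ∣ 1 := ⟨n, by linarith⟩
  exact (Fact.out : p.Prime).one_lt.ne' (by exact_mod_cast Int.eq_one_of_dvd_one (by positivity) h4)

lemma IsStandardCharacter.char_mul [Fact p.Prime] [TopologicalSpace K] {χ : AddChar K Circle}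
    (hχ : IsStandardCharacter p ϖ ε χ)
    (h0 : ϖ ≠ 0) (hkε : (k : Set K) = AddSubgroup.closure (Set.range ε)) (m n : ℕ) :
    χ (u p ϖ ε m * u p ϖ ε n) = 1 := by
  have hq : 1 < p ^ c := one_lt_pow_card
  have key : ∀ n : ℕ, ∀ e ∈ k, ∀ j : ℕ, χ (ϖ ^ (-(j + 1 : ℤ)) * e * u p ϖ ε n) = 1 := by
    intro n
    induction n using base_induction hq with
    | zero => simp [u_zero]
    | step b hb n ih =>
      intro e he j
      have h1 := hχ.apply_mul_zpow hkε (mul_mem he (digit_mem (p := p) hkε b))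
        (show -((j + 1 : ℕ) + 1 : ℤ) ≠ -1 by omega)
      have h2 := ih e he (j + 1)
      have h3 : ϖ ^ (-((j + 1 : ℕ) + 1 : ℤ)) = ϖ ^ (-(j + 1 : ℤ)) * ϖ⁻¹ := by
        rw [← zpow_neg_one, ← zpow_add₀ h0]
        push_cast
        ring_nf
      rw [u_add_mul h0 hq hb]
      rw [h3] at h1 h2
      rw [← one_mul (1 : Circle)]
      nth_rewrite 1 [← h1]
      rw [← h2, ← AddChar.map_add_eq_mul]
      congr 1
      ring
  have key2 : ∀ m : ℕ, ∀ j : ℕ, χ (ϖ ^ (-(j : ℤ)) * u p ϖ ε m * u p ϖ ε n) = 1 := by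
    intro m
    induction m using base_induction hq with
    | zero => simp [u_zero]
    | step b hb m ih =>
      intro j
      have h1 := key n _ (digit_mem (p := p) hkε b) j
      have h2 := ih (j + 1)
      have h3 : ϖ ^ (-(j + 1 : ℤ)) = ϖ ^ (-(j : ℤ)) * ϖ⁻¹ := by
        rw [← zpow_neg_one, ← zpow_add₀ h0]
        congr 1
        ring
      rw [u_add_mul h0 hq hb]
      push_cast at h2
      rw [h3] at h1 h2
      rw [← one_mul (1 : Circle)]
      nth_rewrite 1 [← h1]
      rw [← h2, ← AddChar.map_add_eq_mul]
      congr 1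
      ring
  simpa using key2 m 0

end

section Lattice

variable {K : Type*} [Field K] [ValuativeRel K]

/-- The pair `(μ, χ)` is normalized so that `𝔇` is its own annihilator: `ϖ ^ n 𝔇` has measure
`q ^ (-n)`, and `χ` is trivial on `𝔇` but not at `ϖ⁻¹`. -/
structure IsNormalizedPair [TopologicalSpace K] [MeasurableSpace K] (μ : Measure K)
    (χ : AddChar K Circle) (ϖ : K) (q : ℕ) : Prop where
  prime : IsPrimeElement ϖ
  one_lt : 1 < q
  continuous_char : Continuous χ
  measure_ball : ∀ n : ℤ, μ (ball ϖ n) = (q : ENNReal) ^ (-n)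
  char_ball_zero : ∀ x ∈ ball ϖ 0, χ x = 1
  char_inv : χ ϖ⁻¹ ≠ 1

/-- The sequence `v` enumerates without repetition a subgroup of `K` which is a complement of `𝔇`
and on which the pairing `(x, y) ↦ χ (x y)` is trivial. -/
structure IsDualLattice (χ : AddChar K Circle) (ϖ : K) (v : ℕ → K) : Prop where
  zero : v 0 = 0
  exists_sub_eq : ∀ m n, ∃ l, v m - v n = v l
  exists_sub_mem : ∀ x, ∃ n, x - v n ∈ ball ϖ 0
  eq_of_sub_mem : ∀ m n, v m - v n ∈ ball ϖ 0 → m = n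
  char_mul : ∀ m n, χ (v m * v n) = 1

variable {p c : ℕ} [NeZero c] {ϖ : K} {ε : Fin c → K} {k : Subfield K}
  [TopologicalSpace K] [IsNonarchimedeanLocalField K]

/-- Polynomials in `ϖ` with constant coefficients are dense in `𝔇`, so triviality on monomials
passes to all of `𝔇` by continuity. -/
lemma IsStandardCharacter.char_ball_zero {χ : AddChar K Circle} (hχ : IsStandardCharacter p ϖ ε χ)
    (hϖ : IsPrimeElement ϖ) (hkε : (k : Set K) = AddSubgroup.closure (Set.range ε))
    (hres : ∀ x ∈ ball ϖ 0, ∃ e ∈ k, x - e ∈ ball ϖ 1) {x : K} (hx : x ∈ ball ϖ 0) :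
    χ x = 1 := by
  have h0 := hϖ.ne_zero
  have key : ∀ n : ℕ, ∃ y ∈ ball ϖ (n : ℤ), χ x = χ y := by
    intro n
    induction n with
    | zero => exact ⟨x, by simpa using hx, rfl⟩
    | succ n ih =>
      obtain ⟨y, hy, hxy⟩ := ih
      obtain ⟨e, he, hd⟩ := hres (ϖ ^ (-n : ℤ) * y) (by
        rw [zpow_mul_mem_ball h0]; simpa using hy)
      refine ⟨ϖ ^ (n : ℤ) * (ϖ ^ (-n : ℤ) * y - e), ?_, ?_⟩
      · rw [zpow_mul_mem_ball h0]
        simpa using hd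
      · have h1 := hχ.apply_mul_zpow hkε he (show (n : ℤ) ≠ -1 by omega)
        have h2 : ϖ ^ (n : ℤ) * (ϖ ^ (-n : ℤ) * y - e) = y - e * ϖ ^ (n : ℤ) := by
          rw [mul_sub, ← mul_assoc, ← zpow_add₀ h0]
          simp [mul_comm]
        rw [h2, sub_eq_add_neg, AddChar.map_add_eq_mul, AddChar.map_neg_eq_inv, h1, hxy]
        simp
  choose y hy hxy using key
  have hy0 : Tendsto y atTop (𝓝 0) := by
    rw [(hasBasis_ball hϖ).tendsto_right_iff]
    intro n _
    filter_upwards [eventually_ge_atTop n] with m hm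
    exact ball_anti h0 hϖ.1 (by exact_mod_cast hm) (hy m)
  have h1 : Tendsto (fun n => χ (y n)) atTop (𝓝 1) := by
    have := (hχ.1.tendsto 0).comp hy0
    rwa [AddChar.map_zero_eq_one] at this
  have h2 : Tendsto (fun n => χ (y n)) atTop (𝓝 (χ x)) := by
    simp only [← hxy]
    exact tendsto_const_nhds
  exact tendsto_nhds_unique h2 h1

variable [Fact p.Prime]

lemma measure_ball_add_one [MeasurableSpace K] [BorelSpace K] (μ : Measure K) [μ.IsAddHaarMeasure]
    (hϖ : IsPrimeElement ϖ) [Finite k] (hres : ∀ x ∈ ball ϖ 0, ∃ e ∈ k, x - e ∈ ball ϖ 1)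
    (n : ℤ) : μ (ball ϖ n) = Nat.card k * μ (ball ϖ (n + 1)) := by
  have h0 := hϖ.ne_zero
  have := Fintype.ofFinite k
  have hU : (ball ϖ n : Set K) =
      ⋃ e : k, (fun x => (-(e * ϖ ^ n : K)) + x) ⁻¹' (ball ϖ (n + 1)) := by
    ext x
    simp only [Set.mem_iUnion, Set.mem_preimage, SetLike.mem_coe]
    constructor
    · intro hx
      obtain ⟨e, he, hd⟩ := hres (ϖ ^ (-n) * x) (by rw [zpow_mul_mem_ball h0]; simpa using hx)
      refine ⟨⟨e, he⟩, ?_⟩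
      have : ϖ ^ n * (ϖ ^ (-n) * x - e) ∈ ball ϖ (n + 1) := by
        rw [zpow_mul_mem_ball h0]; simpa using hd
      rw [mul_sub, ← mul_assoc, ← zpow_add₀ h0] at this
      convert this using 1
      simp
      ring
    · rintro ⟨e, he⟩
      have h1 := ball_anti h0 hϖ.1 (by omega : n ≤ n + 1) he
      have h2 : (e : K) * ϖ ^ n ∈ ball ϖ n := by
        rw [mul_comm, zpow_mul_mem_ball h0, sub_self]
        exact mem_ball_zero_of_mem_subfield k e.2
      simpa using add_mem h2 h1
  have hmeas : MeasurableSet (ball ϖ (n + 1) : Set K) := (isOpen_ball hϖ _).measurableSet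
  rw [hU, measure_iUnion]
  · simp [measure_preimage_add, Nat.card_eq_fintype_card]
  · intro e e' hne
    refine Set.disjoint_left.2 fun x hx hx' => hne ?_
    simp only [Set.mem_preimage, SetLike.mem_coe] at hx hx'
    have h1 := sub_mem hx' hx
    have h2 : ϖ ^ n * ((e : K) - e') ∈ ball ϖ (n + 1) := by
      convert h1 using 1; ring
    rw [zpow_mul_mem_ball h0, add_sub_cancel_left] at h2
    exact Subtype.ext (sub_eq_zero.1
      (eq_zero_of_mem_subfield_of_mem_ball_one hϖ k (sub_mem e.2 e'.2) h2))
  · exact fun e => hmeas.preimage (measurable_const_add _)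

lemma measure_ball_eq_zpow [MeasurableSpace K] [BorelSpace K] (μ : Measure K)
    [μ.IsAddHaarMeasure] (hμ : μ {x : K | valuation K x ≤ 1} = 1)
    (hϖ : IsPrimeElement ϖ) (hk : Nat.card k = p ^ c)
    (hres : ∀ x ∈ ball ϖ 0, ∃ e ∈ k, x - e ∈ ball ϖ 1) (n : ℤ) :
    μ (ball ϖ n) = ((p ^ c : ℕ) : ENNReal) ^ (-n) := by
  have hq : 1 < p ^ c := one_lt_pow_card
  have : Finite k := Nat.finite_of_card_ne_zero (by omega)
  have hstep := measure_ball_add_one μ hϖ hres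
  rw [hk] at hstep
  have hq0 : ((p ^ c : ℕ) : ENNReal) ≠ 0 := by exact_mod_cast (by omega)
  have hqt : ((p ^ c : ℕ) : ENNReal) ≠ ⊤ := ENNReal.natCast_ne_top _
  have hzero : μ (ball ϖ 0) = 1 := by rw [coe_ball]; simpa using hμ
  induction n using Int.induction_on with
  | zero => simpa using hzero
  | succ n ih =>
    rw [hstep] at ih
    rw [neg_add, ENNReal.zpow_add hq0 hqt, ← ih, zpow_neg_one, mul_right_comm,
      ENNReal.mul_inv_cancel hq0 hqt, one_mul]
  | pred n ih =>
    rw [hstep, sub_add_cancel, ih, neg_sub, sub_eq_add_neg, ENNReal.zpow_add hq0 hqt, zpow_one]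

theorem IsConstantBasis.isNormalizedPair [MeasurableSpace K] [BorelSpace K] (μ : Measure K)
    [μ.IsAddHaarMeasure] (hμ : μ {x : K | valuation K x ≤ 1} = 1)
    (hϖ : IsPrimeElement ϖ) (hε : IsConstantBasis p c ε)
    (hq : Nat.card (IsLocalRing.ResidueField (valuation K).integer) = p ^ c)
    {χ : AddChar K Circle} (hχ : IsStandardCharacter p ϖ ε χ) :
    IsNormalizedPair μ χ ϖ (p ^ c) := by
  obtain ⟨hε0, k, hk, hkε⟩ := hε
  have : Finite k := Nat.finite_of_card_ne_zero (hk ▸ (one_lt_pow_card (p := p) (c := c)).ne_bot)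
  have hres : ∀ x ∈ ball ϖ 0, ∃ e ∈ k, x - e ∈ ball ϖ 1 := fun x hx =>
    exists_sub_mem_ball_one hϖ k (hq.trans hk.symm) hx
  exact ⟨hϖ, one_lt_pow_card, hχ.1, measure_ball_eq_zpow μ hμ hϖ hk hres,
    fun x hx => hχ.char_ball_zero hϖ hkε hres hx, hχ.char_inv hε0⟩

variable [CharP K p]

lemma eq_zero_of_u_mem (hϖ : IsPrimeElement ϖ) (hk : Nat.card k = p ^ c)
    (hkε : (k : Set K) = AddSubgroup.closure (Set.range ε)) (n : ℕ)
    (hn : u p ϖ ε n ∈ ball ϖ 0) : n = 0 := by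
  have hq : 1 < p ^ c := one_lt_pow_card
  have : Finite k := Nat.finite_of_card_ne_zero (by omega)
  induction n using base_induction hq with
  | zero => rfl
  | step b hb n ih =>
    rw [u_add_mul hϖ.ne_zero hq hb, ← zpow_neg_one, zpow_mul_mem_ball hϖ.ne_zero] at hn
    simp only [sub_neg_eq_add, zero_add] at hn
    have hd := digit_mem (p := p) hkε b
    have h1 : u p ϖ ε n ∈ ball ϖ 0 := by
      have := sub_mem (ball_anti hϖ.ne_zero hϖ.1 zero_le_one hn)
        (mem_ball_zero_of_mem_subfield (ϖ := ϖ) k hd)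
      rwa [add_sub_cancel_left] at this
    obtain rfl := ih h1
    rw [u_zero, add_zero] at hn
    have h2 := eq_zero_of_mem_subfield_of_mem_ball_one hϖ k hd hn
    rw [← digit_zero (p := p) (ε := ε)] at h2
    rw [digit_injOn hk hkε hb (by omega) h2, mul_zero, zero_add]

lemma exists_sub_u_mem (hϖ : IsPrimeElement ϖ)
    (hkε : (k : Set K) = AddSubgroup.closure (Set.range ε))
    (hres : ∀ x ∈ ball ϖ 0, ∃ e ∈ k, x - e ∈ ball ϖ 1) (x : K) :
    ∃ n, x - u p ϖ ε n ∈ ball ϖ 0 := by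
  have hq : 1 < p ^ c := one_lt_pow_card
  have h0 := hϖ.ne_zero
  obtain ⟨N, hN⟩ := exists_mem_ball_neg hϖ x
  induction N generalizing x with
  | zero => exact ⟨0, by simpa [u_zero] using hN⟩
  | succ N ih =>
    have h1 : ϖ ^ (1 : ℤ) * x ∈ ball ϖ (-N : ℤ) := by
      rw [zpow_mul_mem_ball h0]
      convert hN using 2
      push_cast
      ring
    obtain ⟨n, hn⟩ := ih _ h1
    obtain ⟨e, he, hd⟩ := hres _ hn
    obtain ⟨b, hb, rfl⟩ := exists_digit_eq (p := p) hkε he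
    refine ⟨b + p ^ c * n, ?_⟩
    rw [u_add_mul h0 hq hb]
    have : ϖ ^ (-1 : ℤ) * (ϖ ^ (1 : ℤ) * x - u p ϖ ε n - digit p ε b) ∈ ball ϖ 0 := by
      rw [zpow_mul_mem_ball h0]
      simpa using hd
    convert this using 1
    rw [zpow_neg_one, zpow_one]
    field_simp
    ring

theorem IsConstantBasis.isDualLattice (hϖ : IsPrimeElement ϖ) (hε : IsConstantBasis p c ε)
    (hq : Nat.card (IsLocalRing.ResidueField (valuation K).integer) = p ^ c)
    {χ : AddChar K Circle} (hχ : IsStandardCharacter p ϖ ε χ) :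
    IsDualLattice χ ϖ (u p ϖ ε) := by
  obtain ⟨_, k, hk, hkε⟩ := hε
  have : Finite k := Nat.finite_of_card_ne_zero (hk ▸ (one_lt_pow_card (p := p) (c := c)).ne_bot)
  refine ⟨u_zero, exists_u_sub_eq hϖ.ne_zero hkε, exists_sub_u_mem hϖ hkε fun x hx =>
    exists_sub_mem_ball_one hϖ k (hq.trans hk.symm) hx, fun m n h => ?_,
    hχ.char_mul hϖ.ne_zero hkε⟩
  -- `u m - u n` lies in `𝔇` only if it vanishes; then `u m` and `u n` have the same digits.
  have heq : u p ϖ ε m = u p ϖ ε n := by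
    obtain ⟨l, hl⟩ := exists_u_sub_eq (p := p) hϖ.ne_zero hkε m n
    rw [hl] at h
    rw [eq_zero_of_u_mem hϖ hk hkε l h, u_zero] at hl
    exact sub_eq_zero.1 hl
  have hq' : 1 < p ^ c := one_lt_pow_card
  clear h
  induction m using base_induction hq' generalizing n with
  | zero =>
    refine (eq_zero_of_u_mem hϖ hk hkε n ?_).symm
    rw [← heq, u_zero]
    exact zero_mem _
  | step b hb m ih =>
    have hb' := Nat.mod_lt n (by omega : p ^ c > 0)
    rw [← Nat.mod_add_div n (p ^ c)] at heq ⊢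
    rw [u_add_mul hϖ.ne_zero hq' hb, u_add_mul hϖ.ne_zero hq' hb'] at heq
    have h1 := mul_left_cancel₀ (inv_ne_zero hϖ.ne_zero) heq
    obtain ⟨l, hl⟩ := exists_u_sub_eq (p := p) hϖ.ne_zero hkε m (n / p ^ c)
    have hd := sub_mem (digit_mem (p := p) hkε (n % p ^ c)) (digit_mem (p := p) hkε b)
    have h2 : u p ϖ ε l = digit p ε (n % p ^ c) - digit p ε b := by
      rw [← hl]; linear_combination h1
    have h3 := eq_zero_of_u_mem hϖ hk hkε l (h2 ▸ mem_ball_zero_of_mem_subfield k hd)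
    rw [h3, u_zero] at hl h2
    rw [ih _ (sub_eq_zero.1 hl), digit_injOn hk hkε hb hb' (sub_eq_zero.1 h2.symm).symm]

end Lattice

/-! ### Averages over balls and the Plancherel identity -/

section General

variable {K : Type*} [MeasurableSpace K] {μ : Measure K}

lemma eLpNorm_two_sq (f : K → ℂ) : eLpNorm f 2 μ ^ 2 = ∫⁻ x, ‖f x‖ₑ ^ 2 ∂μ := by
  have := eLpNorm_nnreal_pow_eq_lintegral (f := f) (μ := μ) (p := 2) two_ne_zero
  simpa using this

lemma eLpNorm_two_eq_iff (f g : K → ℂ) : eLpNorm f 2 μ = eLpNorm g 2 μ ↔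
    ∫⁻ x, ‖f x‖ₑ ^ 2 ∂μ = ∫⁻ x, ‖g x‖ₑ ^ 2 ∂μ := by
  rw [← eLpNorm_two_sq, ← eLpNorm_two_sq]
  exact ⟨fun h => by rw [h], fun h => le_antisymm
    ((ENNReal.pow_le_pow_left_iff two_ne_zero).1 h.le)
    ((ENNReal.pow_le_pow_left_iff two_ne_zero).1 h.ge)⟩

lemma ofReal_integral_norm_sq {f : K → ℂ} (hf : Integrable (fun x => ‖f x‖ ^ 2) μ) :
    ENNReal.ofReal (∫ x, ‖f x‖ ^ 2 ∂μ) = ∫⁻ x, ‖f x‖ₑ ^ 2 ∂μ := by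
  rw [ofReal_integral_eq_lintegral_ofReal hf (Eventually.of_forall fun x => by positivity)]
  simp only [ENNReal.ofReal_pow (norm_nonneg _), ofReal_norm]

lemma inner₂_eq_inner {f g : K → ℂ} (hf : MemLp f 2 μ) (hg : MemLp g 2 μ) :
    inner₂ μ f g = inner ℂ (hg.toLp g) (hf.toLp f) := by
  rw [L2.inner_def]
  refine integral_congr_ae ?_
  filter_upwards [hf.coeFn_toLp, hg.coeFn_toLp] with x h1 h2
  rw [h1, h2, RCLike.inner_apply]

/-- Continuity of the inner product of `L²`, for representatives. -/
lemma tendsto_inner₂ {f g : ℕ → K → ℂ} {f₀ g₀ : K → ℂ} (hf : ∀ n, MemLp (f n) 2 μ)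
    (hg : ∀ n, MemLp (g n) 2 μ) (hf₀ : MemLp f₀ 2 μ) (hg₀ : MemLp g₀ 2 μ)
    (h1 : Tendsto (fun n => eLpNorm (f n - f₀) 2 μ) atTop (𝓝 0))
    (h2 : Tendsto (fun n => eLpNorm (g n - g₀) 2 μ) atTop (𝓝 0)) :
    Tendsto (fun n => inner₂ μ (f n) (g n)) atTop (𝓝 (inner₂ μ f₀ g₀)) := by
  rw [← Lp.tendsto_Lp_iff_tendsto_eLpNorm'' _ hf _ hf₀] at h1
  rw [← Lp.tendsto_Lp_iff_tendsto_eLpNorm'' _ hg _ hg₀] at h2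
  rw [inner₂_eq_inner hf₀ hg₀]
  simp_rw [fun n => inner₂_eq_inner (hf n) (hg n)]
  exact h2.inner h1

end General

section Average

section

variable {K : Type*} [Field K] [ValuativeRel K] [TopologicalSpace K] [MeasurableSpace K]
  {μ : Measure K} {χ : AddChar K Circle} {ϖ : K} {q : ℕ}

lemma IsNormalizedPair.q_ne_zero (hP : IsNormalizedPair μ χ ϖ q) : (q : ENNReal) ≠ 0 := by
  have := hP.one_lt
  exact_mod_cast (by omega : q ≠ 0)

lemma IsNormalizedPair.measure_ball_ne_zero (hP : IsNormalizedPair μ χ ϖ q) (n : ℤ) :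
    μ (ball ϖ n) ≠ 0 := by
  rw [hP.measure_ball]
  exact (ENNReal.zpow_pos hP.q_ne_zero (ENNReal.natCast_ne_top _) _).ne'

lemma IsNormalizedPair.measure_ball_ne_top (hP : IsNormalizedPair μ χ ϖ q) (n : ℤ) :
    μ (ball ϖ n) ≠ ⊤ := by
  rw [hP.measure_ball]
  exact (ENNReal.zpow_lt_top hP.q_ne_zero (ENNReal.natCast_ne_top _) _).ne

lemma IsNormalizedPair.measurableSet_ball [IsNonarchimedeanLocalField K] [BorelSpace K]
    (hP : IsNormalizedPair μ χ ϖ q) (n : ℤ) : MeasurableSet (ball ϖ n : Set K) :=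
  (isOpen_ball hP.prime n).measurableSet

/-- The average `q ^ n ∫_{ϖ ^ n 𝔇} h (x + y) dy` of `h` over the ball of radius `q ^ (-n)`
around `x`. -/
noncomputable def ballAverage (μ : Measure K) (ϖ : K) (n : ℤ) (h : K → ℂ) (x : K) : ℂ :=
  ∫ y, h (x + y) ∂(ProbabilityTheory.cond μ (ball ϖ n))

lemma IsNormalizedPair.isProbabilityMeasure_cond (hP : IsNormalizedPair μ χ ϖ q) (n : ℤ) :
    IsProbabilityMeasure (ProbabilityTheory.cond μ (ball ϖ n)) :=
  ProbabilityTheory.cond_isProbabilityMeasure_of_finite (hP.measure_ball_ne_zero n)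
    (hP.measure_ball_ne_top n)

lemma IsNormalizedPair.ballAverage_eq (hP : IsNormalizedPair μ χ ϖ q) (n : ℤ) (h : K → ℂ)
    (x : K) :
    ballAverage μ ϖ n h x = (q : ℂ) ^ n * ∫ y in ball ϖ n, h (x + y) ∂μ := by
  rw [ballAverage, ProbabilityTheory.cond, integral_smul_measure, hP.measure_ball,
    ← ENNReal.zpow_neg, neg_neg]
  rw [Complex.real_smul]
  congr 1
  rcases n with n | n <;> simp

end

variable {K : Type*} [Field K] [ValuativeRel K] [TopologicalSpace K]
  [IsNonarchimedeanLocalField K] [MeasurableSpace K] [BorelSpace K] [SecondCountableTopology K]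
  {μ : Measure K} [μ.IsAddHaarMeasure] {χ : AddChar K Circle} {ϖ : K} {q : ℕ}

/-- Translation is continuous in `L²`. -/
lemma tendsto_eLpNorm_translate_sub {h : K → ℂ} (hh : MemLp h 2 μ) :
    Tendsto (fun y => eLpNorm ((fun x => h (x + y)) - h) 2 μ) (𝓝 0) (𝓝 0) := by
  have hc : Continuous fun y : K => ContinuousMap.addRight y :=
    (ContinuousMap.curry ⟨fun z : K × K => z.2 + z.1, by fun_prop⟩).continuous
  have hmp : ∀ y : K, MeasurePreserving (ContinuousMap.addRight y) μ μ := fun y =>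
    measurePreserving_add_right μ y
  have := ((continuous_const (y := hh.toLp h)).compMeasurePreservingLp hc hmp
    (by simp)).tendsto 0
  simp only [Lp.toLp_compMeasurePreserving] at this
  have h2 := tendsto_iff_edist_tendsto_0.1 this
  refine h2.congr fun y => ?_
  rw [Lp.edist_toLp_toLp]
  congr 1
  ext x
  simp

variable (hP : IsNormalizedPair μ χ ϖ q)
include hP

omit [SecondCountableTopology K] in
lemma IsNormalizedPair.integrable_cond {h : K → ℂ} (hh : MemLp h 2 μ) (n : ℤ) (x : K) :
    Integrable (fun y => h (x + y)) (ProbabilityTheory.cond μ (ball ϖ n)) := by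
  have := hP.isProbabilityMeasure_cond n
  have h1 : MemLp (fun y => h (x + y)) 2 μ :=
    hh.comp_measurePreserving (measurePreserving_add_left μ x)
  have h2 : MemLp (fun y => h (x + y)) 2 (ProbabilityTheory.cond μ (ball ϖ n)) :=
    h1.restrict _ |>.smul_measure (ENNReal.inv_ne_top.2 (hP.measure_ball_ne_zero n))
  exact h2.integrable (by norm_num)

lemma IsNormalizedPair.aestronglyMeasurable_ballAverage {h : K → ℂ}
    (hh : AEStronglyMeasurable h μ) (n : ℤ) :
    AEStronglyMeasurable (ballAverage μ ϖ n h) μ := by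
  have := hP.isProbabilityMeasure_cond n
  have h1 : AEStronglyMeasurable (fun z : K × K => h (z.1 + z.2))
      (μ.prod (ProbabilityTheory.cond μ (ball ϖ n))) := by
    have h2 := hh.comp_quasiMeasurePreserving
      (quasiMeasurePreserving_add μ μ)
    refine h2.mono_ac ?_
    exact Measure.AbsolutelyContinuous.rfl.prod ProbabilityTheory.cond_absolutelyContinuous
  exact h1.integral_prod_right'

/-- The averages over shrinking balls converge in `L²`. -/
lemma IsNormalizedPair.tendsto_ballAverage {h : K → ℂ} (hh : MemLp h 2 μ) :
    Tendsto (fun n : ℕ => eLpNorm (ballAverage μ ϖ n h - h) 2 μ) atTop (𝓝 0) := by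
  rw [ENNReal.tendsto_nhds_zero]
  intro δ hδ
  have h1 := (ENNReal.tendsto_nhds_zero.1 (tendsto_eLpNorm_translate_sub hh)) δ hδ
  obtain ⟨N, -, hN⟩ := (hasBasis_ball hP.prime).mem_iff.1 h1
  filter_upwards [eventually_ge_atTop N] with n hn
  have := hP.isProbabilityMeasure_cond (n : ℤ)
  set ν := ProbabilityTheory.cond μ (ball ϖ (n : ℤ))
  rw [← ENNReal.pow_le_pow_left_iff two_ne_zero, eLpNorm_two_sq]
  have hmeas : AEStronglyMeasurable (fun z : K × K => h (z.1 + z.2) - h z.1) (μ.prod ν) := by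
    refine AEStronglyMeasurable.sub ?_ hh.1.comp_fst
    refine (hh.1.comp_quasiMeasurePreserving (quasiMeasurePreserving_add μ μ)).mono_ac ?_
    exact Measure.AbsolutelyContinuous.rfl.prod ProbabilityTheory.cond_absolutelyContinuous
  -- Jensen's inequality for the probability measure `ν`
  have hJ : ∀ᵐ x ∂μ, ‖(ballAverage μ ϖ n h - h) x‖ₑ ^ 2 ≤
      ∫⁻ y, ‖h (x + y) - h x‖ₑ ^ 2 ∂ν := by
    filter_upwards [hmeas.prodMk_left] with x hx
    have e1 : (ballAverage μ ϖ n h - h) x = ∫ y, (h (x + y) - h x) ∂ν := by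
      rw [integral_sub (hP.integrable_cond hh n x) (integrable_const _)]
      simp [ballAverage]
    rw [e1, ← eLpNorm_two_sq]
    gcongr
    calc _ ≤ ∫⁻ y, ‖h (x + y) - h x‖ₑ ∂ν := enorm_integral_le_lintegral_enorm _
      _ = eLpNorm (fun y => h (x + y) - h x) 1 ν := by rw [eLpNorm_one_eq_lintegral_enorm]
      _ ≤ _ := eLpNorm_le_eLpNorm_of_exponent_le (by norm_num) hx
  calc _ ≤ ∫⁻ x, ∫⁻ y, ‖h (x + y) - h x‖ₑ ^ 2 ∂ν ∂μ := lintegral_mono_ae hJ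
    _ = ∫⁻ y, ∫⁻ x, ‖h (x + y) - h x‖ₑ ^ 2 ∂μ ∂ν :=
        lintegral_lintegral_swap (hmeas.enorm.pow_const 2)
    _ ≤ ∫⁻ _, δ ^ 2 ∂ν := by
        refine lintegral_mono_ae ?_
        filter_upwards [ProbabilityTheory.ae_cond_mem (μ := μ) (hP.measurableSet_ball (n : ℤ))]
          with y hy
        rw [← eLpNorm_two_sq (fun x => h (x + y) - h x)]
        gcongr
        exact hN (ball_anti hP.prime.ne_zero hP.prime.1 (by exact_mod_cast hn) hy)
    _ = δ ^ 2 := by simp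

end Average

section Fourier

variable {K : Type*} [Field K] [ValuativeRel K] [TopologicalSpace K]
  [IsNonarchimedeanLocalField K] [MeasurableSpace K] [BorelSpace K] [SecondCountableTopology K]
  {μ : Measure K} [μ.IsAddHaarMeasure] {χ : AddChar K Circle} {ϖ : K} {q : ℕ}

omit [μ.IsAddHaarMeasure] in
lemma continuous_fourierIntegral (hχ : Continuous χ) {h : K → ℂ} (hh : Integrable h μ) :
    Continuous (Fourier.fourierIntegral χ μ h) :=
  VectorFourier.fourierIntegral_continuous hχ (by simpa using continuous_mul) hh

lemma integral_fourierIntegral_mul (hχ : Continuous χ) {f g : K → ℂ} (hf : Integrable f μ)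
    (hg : Integrable g μ) :
    ∫ ξ, Fourier.fourierIntegral χ μ f ξ * g ξ ∂μ =
      ∫ x, f x * Fourier.fourierIntegral χ μ g x ∂μ := by
  have := VectorFourier.integral_fourierIntegral_smul_eq_flip (L := LinearMap.mul K K) (μ := μ)
    (ν := μ) hχ (by simpa using continuous_mul) hf hg
  have hflip : (LinearMap.mul K K).flip = LinearMap.mul K K := by
    ext; simp
  rw [hflip] at this
  exact this

omit [BorelSpace K] [SecondCountableTopology K] [μ.IsAddHaarMeasure] in
lemma IsNormalizedPair.exists_char_ne_one (hP : IsNormalizedPair μ χ ϖ q) {n : ℤ} {x : K}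
    (hx : x ∉ ball ϖ n) : ∃ y ∈ ball ϖ (-n), χ (x * y) ≠ 1 := by
  have h0 := hP.prime.ne_zero
  have hx0 : x ≠ 0 := fun h => hx (h ▸ zero_mem _)
  have hv : valuation K x ≠ 0 := by simpa using hx0
  refine ⟨ϖ⁻¹ * x⁻¹, ?_, ?_⟩
  · have h1 : ϖ ^ n * x⁻¹ ∈ ball ϖ 1 := by
      rw [hP.prime.mem_ball_one, map_mul, map_inv₀, map_zpow₀, ← div_eq_mul_inv,
        div_lt_one₀ (zero_lt_iff.2 hv)]
      exact not_le.1 fun h => hx (mem_ball.2 h)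
    rw [zpow_mul_mem_ball h0] at h1
    rw [← zpow_neg_one, zpow_mul_mem_ball h0]
    convert h1 using 2
    ring
  · rw [mul_comm, inv_mul_cancel_right₀ hx0]
    exact hP.char_inv

omit [IsNonarchimedeanLocalField K] [BorelSpace K] [SecondCountableTopology K]
  [μ.IsAddHaarMeasure] in
lemma IsNormalizedPair.measureReal_ball (hP : IsNormalizedPair μ χ ϖ q) (n : ℤ) :
    μ.real (ball ϖ n) = (q : ℝ) ^ (-n) := by
  rw [Measure.real, hP.measure_ball]
  generalize -n = m
  rcases m with m | m <;> simp

omit [SecondCountableTopology K] in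
/-- The characters `χ (x ·)` integrate to zero over a ball unless they are trivial on it. -/
lemma IsNormalizedPair.integral_char_ball (hP : IsNormalizedPair μ χ ϖ q) (n : ℤ) (x : K) :
    ∫ ξ in (ball ϖ (-n) : Set K), (χ (x * ξ) : ℂ) ∂μ =
      (ball ϖ n : Set K).indicator (fun _ => (q : ℂ) ^ n) x := by
  by_cases hx : x ∈ ball ϖ n
  · rw [Set.indicator_of_mem (by exact hx)]
    have h1 : ∀ ξ ∈ (ball ϖ (-n) : Set K), (χ (x * ξ) : ℂ) = 1 := fun ξ hξ => by
      have := mul_mem_ball hP.prime.ne_zero hx hξ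
      rw [add_neg_cancel] at this
      rw [hP.char_ball_zero _ this, Circle.coe_one]
    rw [setIntegral_congr_fun (hP.measurableSet_ball _) h1]
    simp [hP.measureReal_ball]
  · rw [Set.indicator_of_notMem (by exact hx)]
    obtain ⟨y, hy, hne⟩ := hP.exists_char_ne_one hx
    have hinv := integral_add_left_eq_self (μ := μ)
      ((ball ϖ (-n) : Set K).indicator fun ξ => (χ (x * ξ) : ℂ)) y
    have h2 : (fun ξ => (ball ϖ (-n) : Set K).indicator (fun ξ => (χ (x * ξ) : ℂ)) (y + ξ)) =
        fun ξ => (χ (x * y) : ℂ) *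
          (ball ϖ (-n) : Set K).indicator (fun ξ => (χ (x * ξ) : ℂ)) ξ := by
      ext ξ
      by_cases hξ : ξ ∈ ball ϖ (-n)
      · rw [Set.indicator_of_mem (show y + ξ ∈ (ball ϖ (-n) : Set K) from add_mem hy hξ),
          Set.indicator_of_mem (by exact hξ), mul_add, AddChar.map_add_eq_mul, Circle.coe_mul]
      · rw [Set.indicator_of_notMem (show ξ ∉ (ball ϖ (-n) : Set K) from hξ),
          Set.indicator_of_notMem, mul_zero]
        intro h
        exact hξ (by simpa using sub_mem (show y + ξ ∈ ball ϖ (-n) from h) hy)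
    rw [h2, integral_const_mul, integral_indicator (hP.measurableSet_ball _)] at hinv
    have hne' : (χ (x * y) : ℂ) ≠ 1 := fun h => hne (Circle.ext (by simpa using h))
    by_contra h3
    exact hne' (mul_right_cancel₀ h3 (by rw [hinv, one_mul]))

/-- Truncated Fourier inversion: integrating the transform over the ball `ϖ ^ (-n) 𝔇` recovers
the averages over translates of the dual ball `ϖ ^ n 𝔇`. -/
lemma IsNormalizedPair.integral_fourierIntegral_ball (hP : IsNormalizedPair μ χ ϖ q) {h : K → ℂ}
    (hh : Integrable h μ) (n : ℤ) (x : K) :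
    ∫ ξ in (ball ϖ (-n) : Set K), (χ (x * ξ) : ℂ) * Fourier.fourierIntegral χ μ h ξ ∂μ =
      ballAverage μ ϖ n h x := by
  have := hP.prime.t2Space
  have hcont : Continuous fun ξ : K => (χ (x * ξ) : ℂ) := by
    have := hP.continuous_char
    fun_prop
  have hg : Integrable ((ball ϖ (-n) : Set K).indicator fun ξ => (χ (x * ξ) : ℂ)) μ :=
    (hcont.continuousOn.integrableOn_compact (isCompact_ball _)).integrable_indicator
      (hP.measurableSet_ball _)
  have h1 := integral_fourierIntegral_mul hP.continuous_char hh hg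
  have h2 : ∀ y, Fourier.fourierIntegral χ μ
      ((ball ϖ (-n) : Set K).indicator fun ξ => (χ (x * ξ) : ℂ)) y =
      (ball ϖ n : Set K).indicator (fun _ => (q : ℂ) ^ n) (x - y) := by
    intro y
    rw [Fourier.fourierIntegral_def, ← hP.integral_char_ball,
      ← integral_indicator (hP.measurableSet_ball _)]
    congr 1
    ext ξ
    by_cases hξ : ξ ∈ (ball ϖ (-n) : Set K)
    · rw [Set.indicator_of_mem hξ, Set.indicator_of_mem hξ, Circle.smul_def, smul_eq_mul,
        ← Circle.coe_mul, ← AddChar.map_add_eq_mul]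
      congr 2
      ring
    · rw [Set.indicator_of_notMem hξ, Set.indicator_of_notMem hξ, smul_zero]
  rw [← integral_indicator (hP.measurableSet_ball _), hP.ballAverage_eq,
    ← integral_indicator (hP.measurableSet_ball _), ← integral_const_mul]
  calc _ = ∫ ξ, Fourier.fourierIntegral χ μ h ξ *
        (ball ϖ (-n) : Set K).indicator (fun ξ => (χ (x * ξ) : ℂ)) ξ ∂μ := by
        congr 1
        ext ξ
        by_cases hξ : ξ ∈ (ball ϖ (-n) : Set K)
        · rw [Set.indicator_of_mem hξ, Set.indicator_of_mem hξ, mul_comm]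
        · rw [Set.indicator_of_notMem hξ, Set.indicator_of_notMem hξ, mul_zero]
    _ = ∫ y, h y * (ball ϖ n : Set K).indicator (fun _ => (q : ℂ) ^ n) (x - y) ∂μ := by
        rw [h1]
        simp only [h2]
    _ = ∫ y, h (x + y) * (ball ϖ n : Set K).indicator (fun _ => (q : ℂ) ^ n) (x - (x + y)) ∂μ :=
        (integral_add_left_eq_self _ x).symm
    _ = _ := by
        congr 1
        ext y
        by_cases hy : y ∈ ball ϖ n
        · rw [Set.indicator_of_mem (show y ∈ (ball ϖ n : Set K) from hy), Set.indicator_of_mem,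
            mul_comm]
          simpa using hy
        · rw [Set.indicator_of_notMem (show y ∉ (ball ϖ n : Set K) from hy),
            Set.indicator_of_notMem, mul_zero, mul_zero]
          simpa using hy

omit [SecondCountableTopology K] [μ.IsAddHaarMeasure] in
lemma aecover_ball (hP : IsNormalizedPair μ χ ϖ q) :
    AECover μ atTop fun n : ℕ => (ball ϖ (-(n : ℤ)) : Set K) where
  ae_eventually_mem := Eventually.of_forall fun x => by
    obtain ⟨N, hN⟩ := exists_mem_ball_neg hP.prime x
    filter_upwards [eventually_ge_atTop N] with n hn
    exact ball_anti hP.prime.ne_zero hP.prime.1 (by omega) hN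
  measurableSet n := hP.measurableSet_ball _

lemma IsNormalizedPair.memLp_ballAverage (hP : IsNormalizedPair μ χ ϖ q) {h : K → ℂ}
    (hh : MemLp h 2 μ) : ∀ᶠ n : ℕ in atTop, MemLp (ballAverage μ ϖ n h) 2 μ := by
  filter_upwards [(hP.tendsto_ballAverage hh).eventually_lt_const ENNReal.zero_lt_top] with n hn
  have h1 : MemLp (ballAverage μ ϖ n h - h) 2 μ :=
    ⟨(hP.aestronglyMeasurable_ballAverage hh.1 n).sub hh.1, hn⟩
  simpa using h1.add hh

/-- Plancherel's identity on `L¹ ∩ L²`. -/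
theorem IsNormalizedPair.eLpNorm_fourierIntegral (hP : IsNormalizedPair μ χ ϖ q) {h : K → ℂ}
    (h1 : Integrable h μ) (h2 : MemLp h 2 μ) :
    eLpNorm (Fourier.fourierIntegral χ μ h) 2 μ = eLpNorm h 2 μ := by
  have := hP.prime.t2Space
  set F := Fourier.fourierIntegral χ μ h with hF
  have hFc : Continuous F := continuous_fourierIntegral hP.continuous_char h1
  rw [eLpNorm_two_eq_iff]
  have hsq : ∀ z : ℂ, z * (starRingEnd ℂ) z = ((‖z‖ ^ 2 : ℝ) : ℂ) := fun z => by
    rw [Complex.mul_conj, Complex.normSq_eq_norm_sq]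
  -- the identity on balls, by the multiplication formula and truncated inversion
  have key : ∀ n : ℕ, ((∫ ξ in (ball ϖ (-(n : ℤ)) : Set K), ‖F ξ‖ ^ 2 ∂μ : ℝ) : ℂ) =
      inner₂ μ h (ballAverage μ ϖ n h) := by
    intro n
    have hg : Integrable ((ball ϖ (-(n : ℤ)) : Set K).indicator
        fun ξ => (starRingEnd ℂ) (F ξ)) μ :=
      ((Complex.continuous_conj.comp hFc).continuousOn.integrableOn_compact
        (isCompact_ball _)).integrable_indicator (hP.measurableSet_ball _)
    have e1 := integral_fourierIntegral_mul hP.continuous_char h1 hg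
    have e2 : ∀ x, Fourier.fourierIntegral χ μ ((ball ϖ (-(n : ℤ)) : Set K).indicator
        fun ξ => (starRingEnd ℂ) (F ξ)) x = (starRingEnd ℂ) (ballAverage μ ϖ n h x) := by
      intro x
      rw [← hP.integral_fourierIntegral_ball h1, ← integral_conj, Fourier.fourierIntegral_def,
        ← integral_indicator (hP.measurableSet_ball _)]
      congr 1
      ext ξ
      by_cases hξ : ξ ∈ (ball ϖ (-(n : ℤ)) : Set K)
      · rw [Set.indicator_of_mem hξ, Set.indicator_of_mem hξ, Circle.smul_def, smul_eq_mul,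
          map_mul, ← Circle.coe_inv_eq_conj, AddChar.map_neg_eq_inv, mul_comm ξ x]
      · rw [Set.indicator_of_notMem hξ, Set.indicator_of_notMem hξ, smul_zero]
    simp only [e2] at e1
    rw [inner₂, ← e1, ← integral_complex_ofReal, ← integral_indicator (hP.measurableSet_ball _)]
    congr 1
    ext ξ
    by_cases hξ : ξ ∈ (ball ϖ (-(n : ℤ)) : Set K)
    · rw [Set.indicator_of_mem hξ, Set.indicator_of_mem hξ, hsq]
    · rw [Set.indicator_of_notMem hξ, Set.indicator_of_notMem hξ, mul_zero]
  have hlim : Tendsto (fun n : ℕ => inner₂ μ h (ballAverage μ ϖ n h)) atTop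
      (𝓝 (inner₂ μ h h)) := by
    obtain ⟨N, hN⟩ := eventually_atTop.1 (hP.memLp_ballAverage h2)
    refine (tendsto_add_atTop_iff_nat N).1 ?_
    refine tendsto_inner₂ (f := fun _ => h) (fun _ => h2) (fun n => hN _ (by omega)) h2 h2 ?_ ?_
    · simp
    · exact (tendsto_add_atTop_iff_nat N).2 (hP.tendsto_ballAverage h2)
  have hself : inner₂ μ h h = ((∫ x, ‖h x‖ ^ 2 ∂μ : ℝ) : ℂ) := by
    rw [inner₂, ← integral_complex_ofReal]
    simp only [hsq]
  simp only [← key, hself] at hlim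
  have hlim2 := (Complex.continuous_re.tendsto _).comp hlim
  simp only [Function.comp_def, Complex.ofReal_re] at hlim2
  have hlim3 := (ENNReal.continuous_ofReal.tendsto _).comp hlim2
  have e4 : ∀ n : ℕ, ENNReal.ofReal (∫ ξ in (ball ϖ (-(n : ℤ)) : Set K), ‖F ξ‖ ^ 2 ∂μ) =
      ∫⁻ ξ in (ball ϖ (-(n : ℤ)) : Set K), ‖F ξ‖ₑ ^ 2 ∂μ := fun n =>
    ofReal_integral_norm_sq
      ((hFc.norm.pow 2).continuousOn.integrableOn_compact (isCompact_ball (-(n : ℤ))))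
  simp only [Function.comp_def, ofReal_integral_norm_sq h2.norm.integrable_sq, e4] at hlim3
  refine tendsto_nhds_unique ?_ hlim3
  exact (aecover_ball hP).lintegral_tendsto_of_countably_generated
    (hFc.measurable.enorm.pow_const 2).aemeasurable

end Fourier

/-! ### The Fourier transform on `L²` -/

section FourierL2

variable {K : Type*} [Field K] [ValuativeRel K] [TopologicalSpace K]
  [IsNonarchimedeanLocalField K] [MeasurableSpace K] [BorelSpace K] [SecondCountableTopology K]
  {μ : Measure K} [μ.IsAddHaarMeasure] {χ : AddChar K Circle} {ϖ : K} {q : ℕ}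

lemma tendsto_eLpNorm {α : Type*} [MeasurableSpace α] {μ : Measure α} {f : ℕ → α → ℂ} {f₀ : α → ℂ}
    (hf : ∀ n, MemLp (f n) 2 μ) (hf₀ : MemLp f₀ 2 μ)
    (h : Tendsto (fun n => eLpNorm (f n - f₀) 2 μ) atTop (𝓝 0)) :
    Tendsto (fun n => eLpNorm (f n) 2 μ) atTop (𝓝 (eLpNorm f₀ 2 μ)) := by
  rw [← Lp.tendsto_Lp_iff_tendsto_eLpNorm'' _ hf _ hf₀] at h
  simpa only [Lp.enorm_toLp] using h.enorm

lemma IsNormalizedPair.memLp_fourierIntegral (hP : IsNormalizedPair μ χ ϖ q) {h : K → ℂ}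
    (h1 : Integrable h μ) (h2 : MemLp h 2 μ) : MemLp (Fourier.fourierIntegral χ μ h) 2 μ :=
  ⟨(continuous_fourierIntegral hP.continuous_char h1).aestronglyMeasurable,
    by rw [hP.eLpNorm_fourierIntegral h1 h2]; exact h2.2⟩

lemma IsNormalizedPair.eLpNorm_eq (hP : IsNormalizedPair μ χ ϖ q) {f F : K → ℂ}
    (h : IsFourierTransform μ χ f F) : eLpNorm F 2 μ = eLpNorm f 2 μ := by
  obtain ⟨hf, hF, g, hg, h1, h2⟩ := h
  have e1 := tendsto_eLpNorm (fun n => (hg n).2) hf h1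
  have e2 := tendsto_eLpNorm
    (fun n => hP.memLp_fourierIntegral (memLp_one_iff_integrable.1 (hg n).1) (hg n).2) hF h2
  simp only [fun n => hP.eLpNorm_fourierIntegral (memLp_one_iff_integrable.1 (hg n).1) (hg n).2]
    at e2
  exact tendsto_nhds_unique e2 e1

omit [SecondCountableTopology K] [μ.IsAddHaarMeasure] in
lemma IsNormalizedPair.fourierIntegral_add_smul (hP : IsNormalizedPair μ χ ϖ q) {f g : K → ℂ}
    (hf : Integrable f μ) (hg : Integrable g μ) (c : ℂ) :
    Fourier.fourierIntegral χ μ (f + c • g) =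
      Fourier.fourierIntegral χ μ f + c • Fourier.fourierIntegral χ μ g := by
  have h1 := VectorFourier.fourierIntegral_add (μ := μ) (L := LinearMap.mul K K)
    hP.continuous_char (by simpa using continuous_mul) hf (hg.smul c)
  have h2 := Fourier.fourierIntegral_const_smul χ μ g c
  rw [← h2]
  exact h1

lemma IsNormalizedPair.isFourierTransform_add_smul (hP : IsNormalizedPair μ χ ϖ q)
    {f F g G : K → ℂ} (hf : IsFourierTransform μ χ f F) (hg : IsFourierTransform μ χ g G) (c : ℂ) :
    IsFourierTransform μ χ (f + c • g) (F + c • G) := by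
  obtain ⟨hf, hF, a, ha, ha1, ha2⟩ := hf
  obtain ⟨hg, hG, b, hb, hb1, hb2⟩ := hg
  have key : ∀ {u v : ℕ → K → ℂ} {u₀ v₀ : K → ℂ}, (∀ n, AEStronglyMeasurable (u n) μ) →
      (∀ n, AEStronglyMeasurable (v n) μ) → AEStronglyMeasurable u₀ μ →
      AEStronglyMeasurable v₀ μ → Tendsto (fun n => eLpNorm (u n - u₀) 2 μ) atTop (𝓝 0) →
      Tendsto (fun n => eLpNorm (v n - v₀) 2 μ) atTop (𝓝 0) →
      Tendsto (fun n => eLpNorm (u n + c • v n - (u₀ + c • v₀)) 2 μ) atTop (𝓝 0) := by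
    intro u v u₀ v₀ hu hv hu₀ hv₀ h1 h2
    have h3 : Tendsto (fun n => eLpNorm (u n - u₀) 2 μ + ‖c‖ₑ * eLpNorm (v n - v₀) 2 μ) atTop
        (𝓝 0) := by
      have h4 := h1.add (ENNReal.Tendsto.const_mul h2 (Or.inr (enorm_ne_top (x := c))))
      simpa using h4
    refine tendsto_of_tendsto_of_tendsto_of_le_of_le tendsto_const_nhds h3
      (fun _ => zero_le) fun n => ?_
    have e : u n + c • v n - (u₀ + c • v₀) = (u n - u₀) + c • (v n - v₀) := by
      rw [smul_sub]; abel
    simp only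
    rw [e]
    refine (eLpNorm_add_le ((hu n).sub hu₀) (((hv n).sub hv₀).const_smul c) (by norm_num)).trans ?_
    rw [eLpNorm_const_smul]
  have hi : ∀ n, Integrable (a n) μ := fun n => memLp_one_iff_integrable.1 (ha n).1
  have hi' : ∀ n, Integrable (b n) μ := fun n => memLp_one_iff_integrable.1 (hb n).1
  refine ⟨hf.add (hg.const_smul c), hF.add (hG.const_smul c), fun n => a n + c • b n,
    fun n => ⟨(ha n).1.add ((hb n).1.const_smul c), (ha n).2.add ((hb n).2.const_smul c)⟩,
    key (fun n => (ha n).1.1) (fun n => (hb n).1.1) hf.1 hg.1 ha1 hb1, ?_⟩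
  simp only [fun n => hP.fourierIntegral_add_smul (hi n) (hi' n) c]
  exact key (fun n => (hP.memLp_fourierIntegral (hi n) (ha n).2).1)
    (fun n => (hP.memLp_fourierIntegral (hi' n) (hb n).2).1) hF.1 hG.1 ha2 hb2

/-- Parseval's identity on `L²`, obtained from the equality of norms by polarization. -/
theorem IsNormalizedPair.inner₂_eq (hP : IsNormalizedPair μ χ ϖ q)
    {f F g G : K → ℂ} (hf : IsFourierTransform μ χ f F) (hg : IsFourierTransform μ χ g G) :
    inner₂ μ f g = inner₂ μ F G := by
  rw [inner₂_eq_inner hf.1 hg.1, inner₂_eq_inner hf.2.1 hg.2.1]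
  have key : ∀ c : ℂ, ‖hg.1.toLp g + c • hf.1.toLp f‖ = ‖hg.2.1.toLp G + c • hf.2.1.toLp F‖ := by
    intro c
    rw [← MemLp.toLp_const_smul, ← MemLp.toLp_const_smul, ← MemLp.toLp_add, ← MemLp.toLp_add,
      Lp.norm_toLp, Lp.norm_toLp, hP.eLpNorm_eq (hP.isFourierTransform_add_smul hg hf c)]
  have k1 := key 1
  have k2 := key (-1)
  have k3 := key (-Complex.I)
  have k4 := key Complex.I
  simp only [one_smul, neg_smul, ← sub_eq_add_neg] at k1 k2 k3
  rw [inner_eq_sum_norm_sq_div_four, inner_eq_sum_norm_sq_div_four]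
  simp only [RCLike.I_to_complex]
  rw [k1, k2, k3, k4]

omit [SecondCountableTopology K] [μ.IsAddHaarMeasure] in
lemma IsNormalizedPair.memLp_truncate (hP : IsNormalizedPair μ χ ϖ q) {g : K → ℂ}
    (hg : MemLp g 2 μ) (n : ℤ) :
    MemLp ((ball ϖ n : Set K).indicator g) 1 μ ∧ MemLp ((ball ϖ n : Set K).indicator g) 2 μ := by
  have h2 := hg.indicator (hP.measurableSet_ball n)
  refine ⟨?_, h2⟩
  exact h2.mono_exponent_of_measure_support_ne_top (s := ball ϖ n)
    (fun x hx => Set.indicator_of_notMem hx _) (hP.measure_ball_ne_top n) (by norm_num)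

omit [SecondCountableTopology K] [μ.IsAddHaarMeasure] in
lemma IsNormalizedPair.tendsto_truncate (hP : IsNormalizedPair μ χ ϖ q) {g : K → ℂ}
    (hg : MemLp g 2 μ) :
    Tendsto (fun n : ℕ => eLpNorm ((ball ϖ (-(n : ℤ)) : Set K).indicator g - g) 2 μ) atTop
      (𝓝 0) := by
  have h : Tendsto (fun n : ℕ => eLpNorm ((ball ϖ (-(n : ℤ)) : Set K).indicator g - g) 2 μ ^ 2)
      atTop (𝓝 0) := by
    simp only [eLpNorm_two_sq]
    have hfin : ∫⁻ x, ‖g x‖ₑ ^ 2 ∂μ ≠ ⊤ := by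
      rw [← eLpNorm_two_sq]
      exact ENNReal.pow_ne_top hg.2.ne
    rw [← lintegral_zero (μ := μ)]
    refine tendsto_lintegral_of_dominated_convergence' (fun x => ‖g x‖ₑ ^ 2) (fun n => ?_)
      (fun n => Eventually.of_forall fun x => ?_) hfin (Eventually.of_forall fun x => ?_)
    · exact (((hg.1.indicator (hP.measurableSet_ball _)).sub hg.1).enorm.pow_const 2)
    · by_cases hx : x ∈ (ball ϖ (-(n : ℤ)) : Set K) <;> simp [hx]
    · obtain ⟨N, hN⟩ := exists_mem_ball_neg hP.prime x
      refine tendsto_const_nhds.congr' ?_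
      filter_upwards [eventually_ge_atTop N] with n hn
      have hx : x ∈ (ball ϖ (-(n : ℤ)) : Set K) :=
        ball_anti hP.prime.ne_zero hP.prime.1 (by omega) hN
      rw [Pi.sub_apply, Set.indicator_of_mem hx]
      simp
  have h2 := (ENNReal.continuous_rpow_const (y := (1 / 2 : ℝ))).tendsto 0 |>.comp h
  simp only [Function.comp_def] at h2
  rw [ENNReal.zero_rpow_of_pos (by norm_num)] at h2
  refine h2.congr fun n => ?_
  rw [← ENNReal.rpow_natCast, ← ENNReal.rpow_mul]
  norm_num

theorem IsNormalizedPair.exists_isFourierTransform (hP : IsNormalizedPair μ χ ϖ q) {g : K → ℂ}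
    (hg : MemLp g 2 μ) : ∃ G, IsFourierTransform μ χ g G := by
  let h : ℕ → K → ℂ := fun n => (ball ϖ (-(n : ℤ)) : Set K).indicator g
  have hh : ∀ n, MemLp (h n) 1 μ ∧ MemLp (h n) 2 μ := fun n => hP.memLp_truncate hg _
  have hi : ∀ n, Integrable (h n) μ := fun n => memLp_one_iff_integrable.1 (hh n).1
  have hlim := hP.tendsto_truncate hg
  have hF : ∀ n, MemLp (Fourier.fourierIntegral χ μ (h n)) 2 μ := fun n =>
    hP.memLp_fourierIntegral (hi n) (hh n).2
  have hc : CauchySeq fun n => (hh n).2.toLp (h n) :=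
    ((Lp.tendsto_Lp_iff_tendsto_eLpNorm'' _ (fun n => (hh n).2) _ hg).2 hlim).cauchySeq
  have hc' : CauchySeq fun n => (hF n).toLp _ := by
    rw [EMetric.cauchySeq_iff] at hc ⊢
    intro δ hδ
    obtain ⟨N, hN⟩ := hc δ hδ
    refine ⟨N, fun m hm n hn => ?_⟩
    have h1 := hN m hm n hn
    rw [Lp.edist_toLp_toLp] at h1 ⊢
    have h2 := hP.fourierIntegral_add_smul (hi m) (hi n) (-1)
    rw [neg_one_smul, neg_one_smul, ← sub_eq_add_neg, ← sub_eq_add_neg] at h2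
    rwa [← h2, hP.eLpNorm_fourierIntegral ((hi m).sub (hi n)) ((hh m).2.sub (hh n).2)]
  obtain ⟨G, hG⟩ := cauchySeq_tendsto_of_complete hc'
  refine ⟨G, hg, Lp.memLp G, h, hh, hlim, ?_⟩
  rw [← Lp.tendsto_Lp_iff_tendsto_eLpNorm'' _ hF _ (Lp.memLp G), Lp.toLp_coeFn]
  exact hG

/-- Every function in `L¹ ∩ L²` is a Fourier transform, namely of its inverse transform. -/
theorem IsNormalizedPair.exists_isFourierTransform_eq (hP : IsNormalizedPair μ χ ϖ q) {F : K → ℂ}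
    (h1 : Integrable F μ) (h2 : MemLp F 2 μ) : ∃ f, IsFourierTransform μ χ f F := by
  let f : K → ℂ := fun x => Fourier.fourierIntegral χ μ F (-x)
  have hf : MemLp f 2 μ := (hP.memLp_fourierIntegral h1 h2).comp_measurePreserving
    (Measure.measurePreserving_neg μ)
  refine ⟨f, hf, h2, fun n => (ball ϖ (-(n : ℤ)) : Set K).indicator f,
    fun n => hP.memLp_truncate hf _, hP.tendsto_truncate hf, ?_⟩
  have key : ∀ n : ℕ, Fourier.fourierIntegral χ μ ((ball ϖ (-(n : ℤ)) : Set K).indicator f) =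
      ballAverage μ ϖ n F := by
    intro n
    ext ξ
    rw [← hP.integral_fourierIntegral_ball h1, Fourier.fourierIntegral_def,
      ← integral_indicator (hP.measurableSet_ball _), ← integral_neg_eq_self]
    congr 1
    ext x
    by_cases hx : x ∈ ball ϖ (-(n : ℤ))
    · rw [Set.indicator_of_mem (show -x ∈ (ball ϖ (-(n : ℤ)) : Set K) from neg_mem hx),
        Set.indicator_of_mem (show x ∈ (ball ϖ (-(n : ℤ)) : Set K) from hx), Circle.smul_def,
        smul_eq_mul, neg_mul, neg_neg, mul_comm x]
      simp [f]
    · rw [Set.indicator_of_notMem (show -x ∉ (ball ϖ (-(n : ℤ)) : Set K) from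
          fun h => hx (by simpa using h)),
        Set.indicator_of_notMem (show x ∉ (ball ϖ (-(n : ℤ)) : Set K) from hx), smul_zero]
  simp only [key]
  exact hP.tendsto_ballAverage h2

end FourierL2

/-! ### Dilations and the affine system -/

section Dilation

variable {K : Type*} [Field K] [ValuativeRel K] [TopologicalSpace K]
  [IsNonarchimedeanLocalField K] [MeasurableSpace K] [BorelSpace K] [SecondCountableTopology K]
  {μ : Measure K} [μ.IsAddHaarMeasure] {χ : AddChar K Circle} {ϖ : K} {q : ℕ}

theorem IsNormalizedPair.map_zpow_mul (hP : IsNormalizedPair μ χ ϖ q) (j : ℤ) :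
    μ.map (fun x => ϖ ^ j * x) = (q : ENNReal) ^ j • μ := by
  have h0 : ϖ ^ j ≠ 0 := zpow_ne_zero _ hP.prime.ne_zero
  let e : K ≃ₜ+ K :=
    { Homeomorph.mulLeft₀ (ϖ ^ j) h0 with map_add' := fun x y => mul_add _ x y }
  have he : (fun x => ϖ ^ j * x) = e := rfl
  have := e.isAddHaarMeasure_map μ
  have h1 := Measure.isAddLeftInvariant_eq_smul (μ.map e) μ
  have h2 : μ.map e (ball ϖ 0) = (q : ENNReal) ^ j := by
    rw [← he, Measure.map_apply (measurable_const_mul _) (hP.measurableSet_ball 0)]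
    have : (fun x => ϖ ^ j * x) ⁻¹' (ball ϖ 0 : Set K) = ball ϖ (-j) := by
      ext x
      simp [zpow_mul_mem_ball hP.prime.ne_zero]
    rw [this, hP.measure_ball, neg_neg]
  rw [he, h1]
  rw [h1, Measure.smul_apply, hP.measure_ball, neg_zero, zpow_zero, ENNReal.smul_def, smul_eq_mul,
    mul_one] at h2
  rw [← h2]
  rfl

lemma IsNormalizedPair.lintegral_zpow_mul (hP : IsNormalizedPair μ χ ϖ q) (j : ℤ)
    (f : K → ENNReal) : ∫⁻ x, f (ϖ ^ j * x) ∂μ = (q : ENNReal) ^ j * ∫⁻ x, f x ∂μ := by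
  have h0 : ϖ ^ j ≠ 0 := zpow_ne_zero _ hP.prime.ne_zero
  rw [← smul_eq_mul, ← lintegral_smul_measure, ← hP.map_zpow_mul,
    (measurableEmbedding_mulLeft₀ h0).lintegral_map]

lemma IsNormalizedPair.integral_zpow_mul (hP : IsNormalizedPair μ χ ϖ q) (j : ℤ)
    (f : K → ℂ) : ∫ x, f (ϖ ^ j * x) ∂μ = (q : ℂ) ^ j * ∫ x, f x ∂μ := by
  have h0 : ϖ ^ j ≠ 0 := zpow_ne_zero _ hP.prime.ne_zero
  have h1 : ((q : ENNReal) ^ j).toReal = (q : ℝ) ^ j := by rcases j with j | j <;> simp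
  have h2 := integral_smul_measure (μ := μ) f ((q : ENNReal) ^ j)
  rw [← hP.map_zpow_mul, (measurableEmbedding_mulLeft₀ h0).integral_map, h1] at h2
  rw [h2, Complex.real_smul]
  simp

lemma IsNormalizedPair.quasiMeasurePreserving_zpow_mul (hP : IsNormalizedPair μ χ ϖ q) (j : ℤ) :
    Measure.QuasiMeasurePreserving (fun x => ϖ ^ j * x) μ μ :=
  ⟨measurable_const_mul _, by rw [hP.map_zpow_mul]; exact Measure.smul_absolutelyContinuous⟩

lemma IsNormalizedPair.quasiMeasurePreserving_zpow_mul_sub (hP : IsNormalizedPair μ χ ϖ q) (j : ℤ)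
    (b : K) : Measure.QuasiMeasurePreserving (fun x => ϖ ^ j * x - b) μ μ :=
  (measurePreserving_sub_right μ b).quasiMeasurePreserving.comp
    (hP.quasiMeasurePreserving_zpow_mul j)

omit [IsNonarchimedeanLocalField K] [BorelSpace K] [SecondCountableTopology K]
  [μ.IsAddHaarMeasure] in
lemma IsNormalizedPair.enorm_sq_mul_zpow (hP : IsNormalizedPair μ χ ϖ q) {s : ℝ} {j : ℤ}
    (hs : s ^ 2 = (q : ℝ) ^ j) : ‖(s : ℂ)‖ₑ ^ 2 = (q : ENNReal) ^ j := by
  have hq := hP.one_lt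
  have h0 : (q : ENNReal) ≠ 0 := hP.q_ne_zero
  rw [← ofReal_norm, ← ENNReal.ofReal_pow (norm_nonneg _), Complex.norm_real, Real.norm_eq_abs,
    sq_abs, hs]
  have hq' : (0 : ℝ) < q := by exact_mod_cast (by omega)
  rcases j with j | j
  · simp [ENNReal.ofReal_pow]
  · simp only [zpow_negSucc]
    rw [ENNReal.ofReal_inv_of_pos (by positivity)]
    simp [ENNReal.ofReal_pow]

lemma IsNormalizedPair.eLpNorm_dilate_translate (hP : IsNormalizedPair μ χ ϖ q) {s : ℝ} {j : ℤ}
    (hs : s ^ 2 = (q : ℝ) ^ j) (b : K) (f : K → ℂ) :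
    eLpNorm (fun x => (s : ℂ) * f (ϖ ^ (-j) * x - b)) 2 μ = eLpNorm f 2 μ := by
  rw [eLpNorm_two_eq_iff]
  simp only [enorm_mul, mul_pow]
  rw [lintegral_const_mul' _ _ (ENNReal.pow_ne_top enorm_ne_top),
    hP.lintegral_zpow_mul (-j) (fun x => ‖f (x - b)‖ₑ ^ 2),
    lintegral_sub_right_eq_self (fun x => ‖f x‖ₑ ^ 2), hP.enorm_sq_mul_zpow hs, ← mul_assoc,
    ← ENNReal.zpow_add hP.q_ne_zero (ENNReal.natCast_ne_top _)]
  simp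

lemma IsNormalizedPair.eLpNorm_modulate_dilate (hP : IsNormalizedPair μ χ ϖ q) {s : ℝ} {j : ℤ}
    (hs : s ^ 2 = (q : ℝ) ^ (-j)) (b : K) (f : K → ℂ) :
    eLpNorm (fun x => (s : ℂ) * (χ (-(b * x)) * f (ϖ ^ j * x))) 2 μ = eLpNorm f 2 μ := by
  rw [eLpNorm_two_eq_iff]
  have hχ : ∀ z : Circle, ‖(z : ℂ)‖ₑ = 1 := fun z => by
    rw [← ofReal_norm, Circle.norm_coe, ENNReal.ofReal_one]
  simp only [enorm_mul, mul_pow, hχ, one_mul]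
  rw [lintegral_const_mul' _ _ (ENNReal.pow_ne_top enorm_ne_top),
    hP.lintegral_zpow_mul j (fun x => ‖f x‖ₑ ^ 2),
    hP.enorm_sq_mul_zpow hs, ← mul_assoc,
    ← ENNReal.zpow_add hP.q_ne_zero (ENNReal.natCast_ne_top _)]
  simp

/-- The Fourier transform turns the dilated translate `s f(ϖ⁻ʲ x - b)`, with `s² = qʲ`, into the
modulated dilate `s⁻¹ χ(-ϖʲ b ξ) F(ϖʲ ξ)`. -/
theorem IsNormalizedPair.isFourierTransform_affine (hP : IsNormalizedPair μ χ ϖ q) {s : ℝ} {j : ℤ}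
    (hs : s ^ 2 = (q : ℝ) ^ j) (b : K) {f F : K → ℂ} (h : IsFourierTransform μ χ f F) :
    IsFourierTransform μ χ (fun x => (s : ℂ) * f (ϖ ^ (-j) * x - b))
      (fun ξ => ((s⁻¹ : ℝ) : ℂ) * (χ (-(ϖ ^ j * b * ξ)) * F (ϖ ^ j * ξ))) := by
  have hϖ := hP.prime.ne_zero
  have hq : (0 : ℝ) < q := by exact_mod_cast (by have := hP.one_lt; omega)
  have hs0 : s ≠ 0 := by
    rintro rfl
    have : (0 : ℝ) < (q : ℝ) ^ j := by positivity
    rw [← hs] at this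
    simp at this
  have hs' : (s⁻¹) ^ 2 = (q : ℝ) ^ (-j) := by rw [inv_pow, hs, zpow_neg]
  have hA : ∀ {g : K → ℂ}, AEStronglyMeasurable g μ →
      AEStronglyMeasurable (fun x => (s : ℂ) * g (ϖ ^ (-j) * x - b)) μ := fun hg =>
    (hg.comp_quasiMeasurePreserving (hP.quasiMeasurePreserving_zpow_mul_sub _ b)).const_mul _
  have hB : ∀ {g : K → ℂ}, AEStronglyMeasurable g μ →
      AEStronglyMeasurable
        (fun ξ => ((s⁻¹ : ℝ) : ℂ) * (χ (-(ϖ ^ j * b * ξ)) * g (ϖ ^ j * ξ))) μ := fun hg => by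
    have hc : Continuous fun ξ : K => (χ (-(ϖ ^ j * b * ξ)) : ℂ) := by
      have := hP.continuous_char
      fun_prop
    exact (hc.aestronglyMeasurable.mul
      (hg.comp_quasiMeasurePreserving (hP.quasiMeasurePreserving_zpow_mul j))).const_mul _
  obtain ⟨hf, hF, g, hg, h1, h2⟩ := h
  have hfour : ∀ n, Fourier.fourierIntegral χ μ (fun x => (s : ℂ) * g n (ϖ ^ (-j) * x - b)) =
      fun ξ => ((s⁻¹ : ℝ) : ℂ) * (χ (-(ϖ ^ j * b * ξ)) *
        Fourier.fourierIntegral χ μ (g n) (ϖ ^ j * ξ)) := by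
    intro n
    ext ξ
    rw [Fourier.fourierIntegral_def, Fourier.fourierIntegral_def]
    have e1 := hP.integral_zpow_mul (-j)
      (fun y => (χ (-(ϖ ^ j * y * ξ)) : ℂ) * ((s : ℂ) * g n (y - b)))
    have e2 := integral_add_right_eq_self (μ := μ)
      (fun y => (χ (-(ϖ ^ j * y * ξ)) : ℂ) * ((s : ℂ) * g n (y - b))) b
    have e3 : ∀ x, ϖ ^ j * (ϖ ^ (-j) * x) = x := fun x => by
      rw [← mul_assoc, ← zpow_add₀ hϖ]; simp
    simp only [e3] at e1
    simp only [Circle.smul_def, smul_eq_mul]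
    rw [e1, ← e2]
    have e4 : ∀ y, (χ (-(ϖ ^ j * (y + b) * ξ)) : ℂ) * ((s : ℂ) * g n (y + b - b)) =
        ((s : ℂ) * χ (-(ϖ ^ j * b * ξ))) * ((χ (-(y * (ϖ ^ j * ξ))) : ℂ) * g n y) := by
      intro y
      have : -(ϖ ^ j * (y + b) * ξ) = -(ϖ ^ j * b * ξ) + -(y * (ϖ ^ j * ξ)) := by ring
      rw [this, AddChar.map_add_eq_mul, Circle.coe_mul, add_sub_cancel_right]
      ring
    simp only [e4]
    rw [integral_const_mul]
    have e5 : (q : ℂ) ^ (-j) * (s : ℂ) = ((s⁻¹ : ℝ) : ℂ) := by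
      have : (q : ℂ) ^ (-j) = (((q : ℝ) ^ (-j) : ℝ) : ℂ) := by simp
      rw [this, ← hs', ← Complex.ofReal_mul]
      congr 1
      field_simp
    rw [← e5]
    ring
  have hl1 : ∀ n, MemLp (fun x => (s : ℂ) * g n (ϖ ^ (-j) * x - b)) 1 μ := fun n => by
    refine ⟨hA (hg n).1.1, ?_⟩
    have h3 := (hg n).1.2
    rw [eLpNorm_one_eq_lintegral_enorm] at h3 ⊢
    simp only [enorm_mul]
    rw [lintegral_const_mul' _ _ enorm_ne_top,
      hP.lintegral_zpow_mul (-j) (fun x => ‖g n (x - b)‖ₑ),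
      lintegral_sub_right_eq_self (fun x => ‖g n x‖ₑ)]
    exact ENNReal.mul_lt_top enorm_lt_top (ENNReal.mul_lt_top
      (ENNReal.zpow_lt_top hP.q_ne_zero (ENNReal.natCast_ne_top _) _) h3)
  refine ⟨⟨hA hf.1, ?_⟩, ⟨hB hF.1, ?_⟩, fun n x => (s : ℂ) * g n (ϖ ^ (-j) * x - b),
    fun n => ⟨hl1 n, hA (hg n).2.1, ?_⟩, ?_, ?_⟩
  · rw [hP.eLpNorm_dilate_translate hs]; exact hf.2
  · rw [hP.eLpNorm_modulate_dilate hs']; exact hF.2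
  · rw [hP.eLpNorm_dilate_translate hs]; exact (hg n).2.2
  · refine h1.congr fun n => ?_
    rw [← hP.eLpNorm_dilate_translate hs b]
    congr 1
    ext x
    simp only [Pi.sub_apply]
    ring
  · simp only [hfour]
    refine h2.congr fun n => ?_
    rw [← hP.eLpNorm_modulate_dilate hs' (ϖ ^ j * b)]
    congr 1
    ext x
    simp only [Pi.sub_apply]
    ring

end Dilation

/-! ### Periodization and packing -/

/-- `W` packs under the translations `v n`: translates by distinct elements of the lattice overlap
in null sets only. -/
def Packs {K : Type*} [Field K] [MeasurableSpace K] (μ : Measure K) (v : ℕ → K) (W : Set K) :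
    Prop :=
  ∀ n, n ≠ 0 → μ (W ∩ (fun x => x + v n) ⁻¹' W) = 0

section Lattice

variable {K : Type*} [Field K] [ValuativeRel K] {χ : AddChar K Circle} {ϖ : K} {v : ℕ → K}

lemma IsDualLattice.injective (hΛ : IsDualLattice χ ϖ v) : Function.Injective v := fun m n h =>
  hΛ.eq_of_sub_mem m n (by rw [h, sub_self]; exact zero_mem _)

lemma IsDualLattice.iUnion_cells (hΛ : IsDualLattice χ ϖ v) :
    ⋃ n, (fun x => x - v n) ⁻¹' (ball ϖ 0 : Set K) = Set.univ :=
  Set.eq_univ_of_forall fun x => Set.mem_iUnion.2 (hΛ.exists_sub_mem x)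

lemma IsDualLattice.disjoint_cells (hΛ : IsDualLattice χ ϖ v) :
    Pairwise (Function.onFun Disjoint fun n => (fun x => x - v n) ⁻¹' (ball ϖ 0 : Set K)) := by
  intro m n hmn
  refine Set.disjoint_left.2 fun x hx hx' => hmn (hΛ.eq_of_sub_mem m n ?_)
  have := sub_mem (show x - v n ∈ ball ϖ 0 from hx') (show x - v m ∈ ball ϖ 0 from hx)
  simpa using this

lemma IsDualLattice.char_mul_add (hΛ : IsDualLattice χ ϖ v) (t n : ℕ) (x : K) :
    χ (v t * (x + v n)) = χ (v t * x) := by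
  rw [mul_add, AddChar.map_add_eq_mul, hΛ.char_mul, mul_one]

end Lattice

section Packing

variable {K : Type*} [Field K] [ValuativeRel K] [TopologicalSpace K]
  [IsNonarchimedeanLocalField K] [MeasurableSpace K] [BorelSpace K] [SecondCountableTopology K]
  {μ : Measure K} [μ.IsAddHaarMeasure] {χ : AddChar K Circle} {ϖ : K} {q : ℕ} {v : ℕ → K}

omit [SecondCountableTopology K] in
lemma IsDualLattice.lintegral_eq_tsum (hΛ : IsDualLattice χ ϖ v) (hP : IsNormalizedPair μ χ ϖ q)
    (f : K → ENNReal) :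
    ∫⁻ x, f x ∂μ = ∑' n, ∫⁻ x in (ball ϖ 0 : Set K), f (x + v n) ∂μ := by
  rw [← setLIntegral_univ, ← hΛ.iUnion_cells, lintegral_iUnion
    (fun n => (hP.measurableSet_ball 0).preimage (measurable_sub_const _)) hΛ.disjoint_cells]
  congr 1
  ext n
  rw [← lintegral_indicator ((hP.measurableSet_ball 0).preimage (measurable_sub_const _)),
    ← lintegral_indicator (hP.measurableSet_ball 0), ← lintegral_add_right_eq_self _ (v n)]
  congr 1
  ext x
  by_cases hx : x ∈ (ball ϖ 0 : Set K)
  · rw [Set.indicator_of_mem hx, Set.indicator_of_mem]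
    simpa using hx
  · rw [Set.indicator_of_notMem hx, Set.indicator_of_notMem]
    simpa using hx

omit [SecondCountableTopology K] in
lemma setIntegral_cell (hP : IsNormalizedPair μ χ ϖ q) (F : K → ℂ) (a : K) :
    ∫ x in (fun x => x - a) ⁻¹' (ball ϖ 0 : Set K), F x ∂μ =
      ∫ x in (ball ϖ 0 : Set K), F (x + a) ∂μ := by
  rw [← integral_indicator ((hP.measurableSet_ball 0).preimage (measurable_sub_const _)),
    ← integral_indicator (hP.measurableSet_ball 0), ← integral_add_right_eq_self _ a]
  congr 1
  ext x
  by_cases hx : x ∈ (ball ϖ 0 : Set K)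
  · rw [Set.indicator_of_mem hx, Set.indicator_of_mem]
    simpa using hx
  · rw [Set.indicator_of_notMem hx, Set.indicator_of_notMem]
    simpa using hx

omit [SecondCountableTopology K] in
lemma IsDualLattice.integral_eq_tsum (hΛ : IsDualLattice χ ϖ v) (hP : IsNormalizedPair μ χ ϖ q)
    {F : K → ℂ} (hF : Integrable F μ) :
    ∫ x, F x ∂μ = ∑' n, ∫ x in (ball ϖ 0 : Set K), F (x + v n) ∂μ := by
  have h := (hasSum_integral_iUnion
    (fun n => (hP.measurableSet_ball 0).preimage (measurable_sub_const (v n))) hΛ.disjoint_cells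
    (hF.integrableOn)).tsum_eq
  rw [hΛ.iUnion_cells, setIntegral_univ] at h
  rw [← h]
  exact tsum_congr fun n => setIntegral_cell hP F (v n)

/-- The characters `χ (v t ·)` form a complete orthonormal system on `𝔇`. Since the transform of a
function supported in `𝔇` is constant on cosets of `𝔇`, this is Plancherel's identity on `K`. -/
theorem IsDualLattice.tsum_enorm_sq_integral_ball (hΛ : IsDualLattice χ ϖ v)
    (hP : IsNormalizedPair μ χ ϖ q) {h : K → ℂ}
    (hh : MemLp ((ball ϖ 0 : Set K).indicator h) 2 μ) :
    ∑' t, ‖∫ x in (ball ϖ 0 : Set K), h x * χ (v t * x) ∂μ‖ₑ ^ 2 =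
      ∫⁻ x in (ball ϖ 0 : Set K), ‖h x‖ₑ ^ 2 ∂μ := by
  set f := (ball ϖ 0 : Set K).indicator h with hf
  have hf1 : Integrable f μ := by
    have := hP.memLp_truncate hh 0
    rw [Set.indicator_indicator, Set.inter_self] at this
    exact memLp_one_iff_integrable.1 this.1
  have hpl := (eLpNorm_two_eq_iff _ _).1 (hP.eLpNorm_fourierIntegral hf1 hh)
  have hR : ∫⁻ x, ‖f x‖ₑ ^ 2 ∂μ = ∫⁻ x in (ball ϖ 0 : Set K), ‖h x‖ₑ ^ 2 ∂μ := by
    rw [← lintegral_indicator (hP.measurableSet_ball 0)]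
    congr 1
    ext x
    by_cases hx : x ∈ (ball ϖ 0 : Set K) <;> simp [hf, hx]
  rw [← hR, ← hpl, ← lintegral_neg_eq_self, hΛ.lintegral_eq_tsum hP]
  refine tsum_congr fun t => ?_
  have hconst : ∀ y ∈ (ball ϖ 0 : Set K), ‖Fourier.fourierIntegral χ μ f (-(y + v t))‖ₑ ^ 2 =
      ‖∫ x in (ball ϖ 0 : Set K), h x * χ (v t * x) ∂μ‖ₑ ^ 2 := by
    intro y hy
    congr 2
    rw [Fourier.fourierIntegral_def, ← integral_indicator (hP.measurableSet_ball 0)]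
    congr 1
    ext x
    by_cases hx : x ∈ (ball ϖ 0 : Set K)
    · rw [hf, Set.indicator_of_mem hx, Set.indicator_of_mem hx, Circle.smul_def, smul_eq_mul,
        mul_comm]
      have h1 : x * y ∈ ball ϖ 0 := by simpa using mul_mem_ball hP.prime.ne_zero hx hy
      have h2 : -(x * -(y + v t)) = x * y + v t * x := by ring
      rw [h2, AddChar.map_add_eq_mul, hP.char_ball_zero _ h1, one_mul]
    · rw [hf, Set.indicator_of_notMem hx, Set.indicator_of_notMem hx, smul_zero]
  rw [setLIntegral_congr_fun (hP.measurableSet_ball 0) hconst]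
  simp [hP.measure_ball]

omit [SecondCountableTopology K] in
lemma IsDualLattice.ae_forall_eq (hΛ : IsDualLattice χ ϖ v) {W : Set K} (hW : Packs μ v W) :
    ∀ᵐ x ∂μ, ∀ m n, x + v m ∈ W → x + v n ∈ W → m = n := by
  rw [ae_all_iff]
  intro m
  rw [ae_all_iff]
  intro n
  by_cases hmn : m = n
  · exact Eventually.of_forall fun _ _ _ => hmn
  obtain ⟨l, hl⟩ := hΛ.exists_sub_eq n m
  have hl0 : l ≠ 0 := by
    rintro rfl
    rw [hΛ.zero, sub_eq_zero] at hl
    exact hmn (hΛ.injective hl).symm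
  have h := hW l hl0
  rw [← measure_preimage_add_right μ (v m)] at h
  filter_upwards [measure_eq_zero_iff_ae_notMem.1 h] with x hx h1 h2
  refine absurd ⟨h1, ?_⟩ hx
  rw [Set.mem_preimage, ← hl]
  simpa using h2

/-- Parseval's identity for the characters `χ (v t ·)` and functions supported in a packing set:
the periodization over the lattice has the same norm and the same coefficients. -/
theorem IsDualLattice.tsum_enorm_sq_integral (hΛ : IsDualLattice χ ϖ v)
    (hP : IsNormalizedPair μ χ ϖ q) {W : Set K} (hW : Packs μ v W) {F : K → ℂ}
    (hF1 : Integrable F μ) (hF2 : MemLp F 2 μ) (hFW : ∀ x ∉ W, F x = 0) :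
    ∑' t, ‖∫ x, F x * χ (v t * x) ∂μ‖ₑ ^ 2 = ∫⁻ x, ‖F x‖ₑ ^ 2 ∂μ := by
  have hsub : ∀ᵐ x ∂μ, ∃ m, ∀ n, n ≠ m → F (x + v n) = 0 := by
    filter_upwards [hΛ.ae_forall_eq hW] with x hx
    by_cases hex : ∃ m, x + v m ∈ W
    · obtain ⟨m, hm⟩ := hex
      exact ⟨m, fun n hn => hFW _ fun h => hn (hx n m h hm)⟩
    · exact ⟨0, fun n _ => hFW _ fun h => hex ⟨n, h⟩⟩
  let h : K → ℂ := fun x => ∑' n, F (x + v n)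
  have hFn : ∀ n, AEStronglyMeasurable (fun x => F (x + v n)) μ := fun n =>
    hF1.1.comp_measurePreserving (measurePreserving_add_right μ (v n))
  have hnorm : ∀ᵐ x ∂μ, ‖h x‖ₑ ^ 2 = ∑' n, ‖F (x + v n)‖ₑ ^ 2 := by
    filter_upwards [hsub] with x ⟨m, hm⟩
    rw [tsum_eq_single m fun n hn => by rw [hm n hn]; simp]
    simp only [h]
    rw [tsum_eq_single m hm]
  have hmeas : AEStronglyMeasurable h μ := by
    refine aestronglyMeasurable_of_tendsto_ae atTop
      (f := fun N x => ∑ n ∈ Finset.range N, F (x + v n))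
      (fun N => Finset.aestronglyMeasurable_fun_sum _ fun n _ => hFn n) ?_
    filter_upwards [hsub] with x ⟨m, hm⟩
    exact (hasSum_single m hm).summable.hasSum.tendsto_sum_nat
  have hsum : ∫⁻ x in (ball ϖ 0 : Set K), ‖h x‖ₑ ^ 2 ∂μ = ∫⁻ x, ‖F x‖ₑ ^ 2 ∂μ := by
    rw [hΛ.lintegral_eq_tsum hP, ← lintegral_tsum fun n => ((hFn n).enorm.pow_const 2).restrict]
    exact lintegral_congr_ae (ae_restrict_of_ae hnorm)
  have hh : MemLp ((ball ϖ 0 : Set K).indicator h) 2 μ := by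
    refine ⟨hmeas.indicator (hP.measurableSet_ball 0), ?_⟩
    rw [eLpNorm_indicator_eq_eLpNorm_restrict (hP.measurableSet_ball 0)]
    refine lt_top_iff_ne_top.2 fun htop => ENNReal.pow_ne_top (n := 2) hF2.2.ne ?_
    rw [eLpNorm_two_sq, ← hsum, ← eLpNorm_two_sq, htop, ENNReal.top_pow two_ne_zero]
  rw [← hsum, ← hΛ.tsum_enorm_sq_integral_ball hP hh]
  refine tsum_congr fun t => ?_
  congr 2
  have hχc : Continuous fun x : K => (χ (v t * x) : ℂ) := by
    have := hP.continuous_char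
    fun_prop
  have hχn : ∀ z : Circle, ‖(z : ℂ)‖ₑ = 1 := fun z => by
    rw [← ofReal_norm, Circle.norm_coe, ENNReal.ofReal_one]
  have hint : Integrable (fun x => F x * χ (v t * x)) μ := by
    refine ⟨hF1.1.mul hχc.aestronglyMeasurable, ?_⟩
    have := hF1.2
    rw [HasFiniteIntegral] at this ⊢
    simpa only [enorm_mul, hχn, mul_one] using this
  rw [hΛ.integral_eq_tsum hP hint]
  simp only [hΛ.char_mul_add]
  rw [← integral_tsum]
  · congr 1
    ext x
    exact tsum_mul_right
  · exact fun n => ((hFn n).mul hχc.aestronglyMeasurable).restrict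
  · simp only [enorm_mul, hχn, mul_one]
    rw [← hΛ.lintegral_eq_tsum hP fun x => ‖F x‖ₑ]
    exact hF1.2.ne

/-- If the characters `χ (v t ·)` satisfy Bessel's inequality on the indicators of all subsets of
`W`, then `W` packs: on the part of `W` lying over an overlap of two translates of `𝔇`, the
periodized indicator takes the value `2`, and its square integral exceeds its integral. -/
theorem IsDualLattice.packs_of_bessel (hΛ : IsDualLattice χ ϖ v)
    (hP : IsNormalizedPair μ χ ϖ q) {W : Set K} (hWm : MeasurableSet W)
    (hB : ∀ A ⊆ W, MeasurableSet A → μ A ≠ ⊤ →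
      ∑' t, ‖∫ x in A, (χ (v t * x) : ℂ) ∂μ‖ₑ ^ 2 ≤ μ A) : Packs μ v W := by
  intro l hl
  have hD := hP.measurableSet_ball 0
  have key : ∀ m n, m ≠ n → μ ((ball ϖ 0 : Set K) ∩
      ((fun x => x + v m) ⁻¹' W ∩ (fun x => x + v n) ⁻¹' W)) = 0 := by
    intro m n hmn
    set E : ℕ → Set K := fun n => (ball ϖ 0 : Set K) ∩ (fun x => x + v n) ⁻¹' W with hE
    have hEm : ∀ n, MeasurableSet (E n) := fun n =>
      hD.inter (hWm.preimage (measurable_add_const _))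
    have hEfin : ∀ n, μ (E n) ≠ ⊤ := fun n =>
      ((measure_mono Set.inter_subset_left).trans_lt (hP.measure_ball_ne_top 0).lt_top).ne
    let B : ℕ → Set K := fun n => (fun x => x - v n) ⁻¹' E n
    have hBm : ∀ n, MeasurableSet (B n) := fun n => (hEm n).preimage (measurable_sub_const _)
    have hBμ : ∀ n, μ (B n) = μ (E n) := fun n => by
      simpa only [B, sub_eq_add_neg] using measure_preimage_add_right μ (-v n) (E n)
    have hdisj : Disjoint (B m) (B n) :=
      (hΛ.disjoint_cells hmn).mono (Set.preimage_mono Set.inter_subset_left)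
        (Set.preimage_mono Set.inter_subset_left)
    have hBW : ∀ n, B n ⊆ W := fun n x hx => by simpa [B, hE] using hx.2
    have hμA : μ (B m ∪ B n) = μ (E m) + μ (E n) := by
      rw [measure_union hdisj (hBm n), hBμ, hBμ]
    have hb := hB (B m ∪ B n) (Set.union_subset (hBW m) (hBW n)) ((hBm m).union (hBm n))
      (by rw [hμA]; exact ENNReal.add_ne_top.2 ⟨hEfin m, hEfin n⟩)
    let h : K → ℂ := fun x => (E m).indicator 1 x + (E n).indicator 1 x
    have hcoef : ∀ t, ∫ x in B m ∪ B n, (χ (v t * x) : ℂ) ∂μ =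
        ∫ x in (ball ϖ 0 : Set K), h x * χ (v t * x) ∂μ := by
      intro t
      have hφc : Continuous fun x : K => (χ (v t * x) : ℂ) := by
        have := hP.continuous_char
        fun_prop
      have hφ : ∀ s : Set K, μ s ≠ ⊤ → IntegrableOn (fun x : K => (χ (v t * x) : ℂ)) s μ :=
        fun s hs => IntegrableOn.of_bound hs.lt_top hφc.aestronglyMeasurable.restrict 1
          (Eventually.of_forall fun x => (Circle.norm_coe _).le)
      have hcell : ∀ n, ∫ x in B n, (χ (v t * x) : ℂ) ∂μ = ∫ x in E n, (χ (v t * x) : ℂ) ∂μ := by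
        intro n
        rw [← integral_indicator (hBm n), ← integral_indicator (hEm n),
          ← integral_add_right_eq_self _ (v n)]
        congr 1
        ext x
        by_cases hx : x ∈ E n
        · rw [Set.indicator_of_mem hx, Set.indicator_of_mem, hΛ.char_mul_add]
          simpa [B] using hx
        · rw [Set.indicator_of_notMem hx, Set.indicator_of_notMem]
          simpa [B] using hx
      have hball : ∀ n, ∫ x in E n, (χ (v t * x) : ℂ) ∂μ =
          ∫ x in (ball ϖ 0 : Set K), (E n).indicator (fun x => (χ (v t * x) : ℂ)) x ∂μ := by
        intro n
        rw [setIntegral_indicator (hEm n), Set.inter_eq_right.2 Set.inter_subset_left]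
      rw [setIntegral_union hdisj (hBm n) (hφ _ ((hBμ m).trans_ne (hEfin m)))
        (hφ _ ((hBμ n).trans_ne (hEfin n))), hcell, hcell, hball m, hball n, ← integral_add]
      · congr 1
        ext x
        by_cases h1 : x ∈ E m <;> by_cases h2 : x ∈ E n <;> simp [h, h1, h2]
        ring
      · exact ((hφ _ (hEfin m)).integrable_indicator (hEm m)).integrableOn
      · exact ((hφ _ (hEfin n)).integrable_indicator (hEm n)).integrableOn
    have hh : MemLp ((ball ϖ 0 : Set K).indicator h) 2 μ := by
      refine MemLp.indicator hD (MemLp.add ?_ ?_)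
      · exact memLp_indicator_const 2 (hEm m) 1 (Or.inr (hEfin m))
      · exact memLp_indicator_const 2 (hEm n) 1 (Or.inr (hEfin n))
    simp only [hcoef] at hb
    rw [hΛ.tsum_enorm_sq_integral_ball hP hh, hμA] at hb
    have hsq : ∀ x, ‖h x‖ₑ ^ 2 = (E m).indicator 1 x + (E n).indicator 1 x +
        2 * (E m ∩ E n).indicator 1 x := by
      intro x
      by_cases h1 : x ∈ E m <;> by_cases h2 : x ∈ E n <;> simp [h, h1, h2]
      have : ((1 : ℂ) + 1) = ((2 : ℝ) : ℂ) := by norm_num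
      rw [this, ← ofReal_norm, Complex.norm_real]
      norm_num
    have hint : ∫⁻ x in (ball ϖ 0 : Set K), ‖h x‖ₑ ^ 2 ∂μ =
        μ (E m) + μ (E n) + 2 * μ (E m ∩ E n) := by
      simp only [hsq]
      rw [lintegral_add_right _ (by
          exact (measurable_one.indicator ((hEm m).inter (hEm n))).const_mul _),
        lintegral_add_right _ (measurable_one.indicator (hEm n)),
        lintegral_const_mul _ (measurable_one.indicator ((hEm m).inter (hEm n))),
        lintegral_indicator_one (hEm m), lintegral_indicator_one (hEm n),
        lintegral_indicator_one ((hEm m).inter (hEm n)), Measure.restrict_apply (hEm m),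
        Measure.restrict_apply (hEm n), Measure.restrict_apply ((hEm m).inter (hEm n)),
        Set.inter_eq_left.2 (Set.inter_subset_left : E m ⊆ _),
        Set.inter_eq_left.2 (Set.inter_subset_left : E n ⊆ _),
        Set.inter_eq_left.2 (Set.inter_subset_left.trans (Set.inter_subset_left : E m ⊆ _))]
    rw [hint] at hb
    have h0 : 2 * μ (E m ∩ E n) ≤ 0 := by
      refine (ENNReal.add_le_add_iff_left (ENNReal.add_ne_top.2 ⟨hEfin m, hEfin n⟩)).1 ?_
      simpa using hb
    have h1 : μ (E m ∩ E n) = 0 := by simpa using h0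
    rw [← h1]
    congr 1
    ext x
    simp only [hE, Set.mem_inter_iff]
    tauto
  -- reduce the overlap with the translate by `v l` to the cells of the lattice
  have hcover : W ∩ (fun x => x + v l) ⁻¹' W ⊆ ⋃ n, (fun x => x - v n) ⁻¹' ((ball ϖ 0 : Set K) ∩
      ((fun x => x + v n) ⁻¹' W ∩ (fun x => x + (v n + v l)) ⁻¹' W)) := by
    rintro x ⟨h1, h2⟩
    obtain ⟨n, hn⟩ := hΛ.exists_sub_mem x
    refine Set.mem_iUnion.2 ⟨n, hn, ?_, ?_⟩
    · simpa using h1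
    · simpa [← add_assoc] using h2
  refine measure_mono_null hcover (measure_iUnion_null fun n => ?_)
  obtain ⟨n', hn'⟩ := hΛ.exists_sub_eq 0 n
  obtain ⟨m, hm⟩ := hΛ.exists_sub_eq l n'
  have hm' : v n + v l = v m := by rw [← hm, ← hn', hΛ.zero]; ring
  have hnm : n ≠ m := by
    rintro rfl
    exact hl (hΛ.injective (by rw [hΛ.zero]; simpa using hm'))
  rw [hm']
  simpa only [sub_eq_add_neg] using
    (measure_preimage_add_right μ (-v n) _).trans (key n m hnm)

end Packing

/-! ### Parseval framelets -/

lemma dilate_eq_preimage {K : Type*} [Field K] {ϖ : K} (h0 : ϖ ≠ 0) (j : ℤ) (S : Set K) :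
    dilate ϖ j S = (fun x => ϖ ^ (-j) * x) ⁻¹' S := by
  have hj : ϖ ^ j ≠ 0 := zpow_ne_zero _ h0
  ext x
  simp only [dilate, Set.mem_image, Set.mem_preimage, zpow_neg]
  constructor
  · rintro ⟨y, hy, rfl⟩
    rwa [inv_mul_cancel_left₀ hj]
  · intro h
    exact ⟨_, h, mul_inv_cancel_left₀ hj x⟩

lemma dilate_zero {K : Type*} [Field K] (ϖ : K) (S : Set K) : dilate ϖ 0 S = S := by
  simp [dilate]

/-- The Parseval condition as an identity between extended nonnegative numbers. -/
lemma isParsevalMultiframelet_iff {K : Type*} [Field K] [MeasurableSpace K] {μ : Measure K}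
    {ϖ : K} {p c : ℕ} {ε : Fin c → K} {L : ℕ} {f : Fin L → K → ℂ} :
    IsParsevalMultiframelet μ p ϖ ε f ↔ (∀ l, MemLp (f l) 2 μ) ∧ ∀ g : K → ℂ, MemLp g 2 μ →
      ∑' i : Fin L × ℤ × ℕ, ‖inner₂ μ g (affine p ϖ ε (f i.1) i.2.1 i.2.2)‖ₑ ^ 2 =
        ∫⁻ x, ‖g x‖ₑ ^ 2 ∂μ := by
  refine and_congr_right fun _ => forall_congr' fun g => imp_congr_right fun hg => ?_
  have hI := ofReal_integral_norm_sq hg.norm.integrable_sq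
  have hen : ∀ z : ℂ, ENNReal.ofReal (‖z‖ ^ 2) = ‖z‖ₑ ^ 2 := fun z => by
    rw [ENNReal.ofReal_pow (norm_nonneg _), ofReal_norm]
  rw [← hI]
  simp only [← hen, one_mul]
  constructor
  · rintro ⟨S, hS, h1, h2⟩
    rw [← ENNReal.ofReal_tsum_of_nonneg (fun _ => by positivity) hS.summable, hS.tsum_eq,
      le_antisymm h2 h1]
  · intro h
    have h2 := ENNReal.hasSum_toReal (h.trans_ne ENNReal.ofReal_ne_top)
    rw [← ENNReal.tsum_toReal_eq (fun _ => ENNReal.ofReal_ne_top), h,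
      ENNReal.toReal_ofReal (integral_nonneg fun _ => by positivity)] at h2
    refine ⟨_, ?_, le_rfl, le_rfl⟩
    convert h2 using 2 with i
    rw [ENNReal.toReal_ofReal (by positivity)]

section Framelet

variable {K : Type*} [Field K] [ValuativeRel K] [TopologicalSpace K]
  [IsNonarchimedeanLocalField K] [MeasurableSpace K] [BorelSpace K] [SecondCountableTopology K]
  {μ : Measure K} [μ.IsAddHaarMeasure] {χ : AddChar K Circle} {ϖ : K} {q : ℕ} {v : ℕ → K}

omit [SecondCountableTopology K] [μ.IsAddHaarMeasure] in
lemma IsNormalizedPair.measurableSet_dilate (hP : IsNormalizedPair μ χ ϖ q) {W : Set K}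
    (hW : MeasurableSet W) (j : ℤ) : MeasurableSet (dilate ϖ j W) := by
  rw [dilate_eq_preimage hP.prime.ne_zero]
  exact hW.preimage (measurable_const_mul _)

lemma IsNormalizedPair.measure_dilate_inter_translate (hP : IsNormalizedPair μ χ ϖ q) (j : ℤ)
    (S : Set K) (a : K) : μ (dilate ϖ j S ∩ translate (dilate ϖ j S) a) =
      (q : ENNReal) ^ (-j) * μ (S ∩ (fun x => x + ϖ ^ (-j) * a) ⁻¹' S) := by
  have h0 := hP.prime.ne_zero
  have hj : ϖ ^ (-j) ≠ 0 := zpow_ne_zero _ h0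
  have h1 : dilate ϖ j S ∩ translate (dilate ϖ j S) a = (fun x => ϖ ^ (-j) * x) ⁻¹'
      ((fun x => x + -(ϖ ^ (-j) * a)) ⁻¹' (S ∩ (fun x => x + ϖ ^ (-j) * a) ⁻¹' S)) := by
    have h2 : translate (dilate ϖ j S) a = (fun x => x + -a) ⁻¹' dilate ϖ j S := by
      ext x
      simp only [translate, Set.mem_image, Set.mem_preimage]
      exact ⟨fun ⟨y, hy, h⟩ => by rw [← h]; simpa using hy, fun h => ⟨_, h, by ring⟩⟩
    rw [h2, dilate_eq_preimage h0]
    ext x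
    simp only [Set.mem_inter_iff, Set.mem_preimage, mul_add, mul_neg, neg_add_cancel_right]
    tauto
  rw [h1, ← (measurableEmbedding_mulLeft₀ hj).map_apply, hP.map_zpow_mul, Measure.smul_apply,
    measure_preimage_add_right, smul_eq_mul]

/-- Since `ϖ⁻ʲ u(t) = u(qʲ t)` and every positive integer is `qʲ t` with `q ∤ t`, the disjointness
of translates at all scales is the packing property of each piece. -/
theorem translatesDisjoint_iff {p c : ℕ} {ε : Fin c → K} (hP : IsNormalizedPair μ χ ϖ (p ^ c))
    {L : ℕ} (W : Fin L → Set K) :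
    TranslatesDisjoint μ p ϖ ε W ↔ ∀ m, Packs μ (u p ϖ ε) (W m) := by
  have hq := hP.one_lt
  have key : ∀ m (j t : ℕ), μ (dilate ϖ j (W m) ∩ translate (dilate ϖ j (W m)) (u p ϖ ε t)) = 0 ↔
      μ (W m ∩ (fun x => x + u p ϖ ε ((p ^ c) ^ j * t)) ⁻¹' W m) = 0 := by
    intro m j t
    rw [hP.measure_dilate_inter_translate, u_pow_mul hP.prime.ne_zero hq, mul_eq_zero]
    exact or_iff_right
      (ENNReal.zpow_pos hP.q_ne_zero (ENNReal.natCast_ne_top _) _).ne'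
  constructor
  · intro h m n hn
    obtain ⟨j, t, ht, rfl⟩ := Nat.exists_eq_pow_mul_and_not_dvd hn (p ^ c) hq.ne'
    exact (key m j t).1 (h m j t ht)
  · intro h m j t ht
    refine (key m j t).2 (h m _ (mul_ne_zero (pow_ne_zero _ (by omega)) ?_))
    rintro rfl
    exact ht (dvd_zero _)

omit [SecondCountableTopology K] in
lemma IsDualLattice.measure_le_one (hΛ : IsDualLattice χ ϖ v) (hP : IsNormalizedPair μ χ ϖ q)
    {W : Set K} (hWm : MeasurableSet W) (hW : Packs μ v W) : μ W ≤ 1 := by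
  have hmeas : ∀ n, Measurable fun x => W.indicator (1 : K → ENNReal) (x + v n) := fun n =>
    (measurable_one.indicator hWm).comp (measurable_add_const (v n))
  rw [← lintegral_indicator_one hWm, hΛ.lintegral_eq_tsum hP,
    ← lintegral_tsum fun n => (hmeas n).aemeasurable]
  calc _ ≤ ∫⁻ x in (ball ϖ 0 : Set K), 1 ∂μ := by
        refine lintegral_mono_ae (ae_restrict_of_ae ?_)
        filter_upwards [hΛ.ae_forall_eq hW] with x hx
        by_cases hex : ∃ m, x + v m ∈ W
        · obtain ⟨m, hm⟩ := hex
          rw [tsum_eq_single m fun n hn =>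
            Set.indicator_of_notMem (fun h => hn (hx n m h hm)) _]
          exact Set.indicator_le_self' (fun _ _ => zero_le) _
        · rw [ENNReal.tsum_eq_zero.2 fun n => Set.indicator_of_notMem (fun h => hex ⟨n, h⟩) _]
          exact zero_le
    _ = 1 := by simp [hP.measure_ball]

/-- The coefficients of `g` against the affine system of `f`, when `f` has transform `1_W`. -/
lemma IsNormalizedPair.inner₂_affine (hP : IsNormalizedPair μ χ ϖ q) {W : Set K} {f g G : K → ℂ}
    (hf : IsFourierTransform μ χ f (W.indicator 1)) (hg : IsFourierTransform μ χ g G) {s : ℝ}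
    {j : ℤ} (hs : s ^ 2 = (q : ℝ) ^ j) (b : K) :
    inner₂ μ g (fun x => (s : ℂ) * f (ϖ ^ (-j) * x - b)) =
      ∫ y, ((s : ℂ) * W.indicator (fun y => G (ϖ ^ (-j) * y)) y) * χ (b * y) ∂μ := by
  have hϖ := hP.prime.ne_zero
  rw [hP.inner₂_eq hg (hP.isFourierTransform_affine hs b hf), inner₂]
  have e1 := hP.integral_zpow_mul j (fun y => ((s⁻¹ : ℝ) : ℂ) *
    (W.indicator (fun y => G (ϖ ^ (-j) * y)) y * χ (b * y)))
  have hq : (0 : ℝ) < q := by exact_mod_cast (by have := hP.one_lt; omega)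
  have hs0 : s ≠ 0 := by
    rintro rfl
    have : (0 : ℝ) < (q : ℝ) ^ j := by positivity
    rw [← hs] at this
    simp at this
  have e2 : (q : ℂ) ^ j * ((s⁻¹ : ℝ) : ℂ) = s := by
    have : (q : ℂ) ^ j = (((q : ℝ) ^ j : ℝ) : ℂ) := by simp
    rw [this, ← hs, ← Complex.ofReal_mul]
    congr 1
    field_simp
  have e0 : ∫ y, ((s : ℂ) * W.indicator (fun y => G (ϖ ^ (-j) * y)) y) * χ (b * y) ∂μ =
      (q : ℂ) ^ j * ∫ y, ((s⁻¹ : ℝ) : ℂ) *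
        (W.indicator (fun y => G (ϖ ^ (-j) * y)) y * χ (b * y)) ∂μ := by
    rw [integral_const_mul, ← mul_assoc, e2, ← integral_const_mul]
    exact integral_congr_ae (Eventually.of_forall fun y => mul_assoc _ _ _)
  rw [e0, ← e1]
  congr 1
  ext ξ
  have e3 : ϖ ^ (-j) * ϖ ^ j = 1 := by rw [← zpow_add₀ hϖ]; simp
  have e4 : (starRingEnd ℂ) (χ (-(ϖ ^ j * b * ξ)) : ℂ) = χ (b * (ϖ ^ j * ξ)) := by
    rw [← Circle.coe_inv_eq_conj, ← AddChar.map_neg_eq_inv, neg_neg, mul_comm (ϖ ^ j) b,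
      mul_assoc]
  by_cases hξ : ϖ ^ j * ξ ∈ W
  · rw [Set.indicator_of_mem hξ, Set.indicator_of_mem hξ, map_mul, map_mul, e4,
      Complex.conj_ofReal, ← mul_assoc (ϖ ^ (-j)), e3, one_mul]
    simp only [Pi.one_apply, map_one]
    ring
  · rw [Set.indicator_of_notMem hξ, Set.indicator_of_notMem hξ]
    simp

/-- At each scale, the coefficients of `g` against the translates of `f` carry exactly the energy
of `ĝ` on the corresponding dilate of the packing set `W`. -/
theorem IsDualLattice.tsum_enorm_sq_inner₂ (hΛ : IsDualLattice χ ϖ v)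
    (hP : IsNormalizedPair μ χ ϖ q) {W : Set K} (hWm : MeasurableSet W) (hW : Packs μ v W)
    {f g G : K → ℂ} (hf : IsFourierTransform μ χ f (W.indicator 1))
    (hg : IsFourierTransform μ χ g G) {s : ℝ} {j : ℤ} (hs : s ^ 2 = (q : ℝ) ^ j) :
    ∑' t, ‖inner₂ μ g (fun x => (s : ℂ) * f (ϖ ^ (-j) * x - v t))‖ₑ ^ 2 =
      ∫⁻ x in dilate ϖ (-j) W, ‖G x‖ₑ ^ 2 ∂μ := by
  have hϖ := hP.prime.ne_zero
  simp only [fun t => hP.inner₂_affine hf hg hs (v t)]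
  set F : K → ℂ := fun y => (s : ℂ) * W.indicator (fun y => G (ϖ ^ (-j) * y)) y with hF
  have hGm : AEStronglyMeasurable (fun y => G (ϖ ^ (-j) * y)) μ :=
    hg.2.1.1.comp_quasiMeasurePreserving (hP.quasiMeasurePreserving_zpow_mul _)
  have hnorm : ∫⁻ y, ‖F y‖ₑ ^ 2 ∂μ = ∫⁻ x in dilate ϖ (-j) W, ‖G x‖ₑ ^ 2 ∂μ := by
    have e0 : ∀ y, ‖F y‖ₑ ^ 2 = (q : ENNReal) ^ j *
        (dilate ϖ (-j) W).indicator (fun x => ‖G x‖ₑ ^ 2) (ϖ ^ (-j) * y) := by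
      intro y
      have e3 : ϖ ^ j * (ϖ ^ (-j) * y) = y := by
        rw [← mul_assoc, ← zpow_add₀ hϖ]; simp
      rw [hF, enorm_mul, mul_pow, hP.enorm_sq_mul_zpow hs, dilate_eq_preimage hϖ, neg_neg]
      congr 1
      by_cases hy : y ∈ W
      · rw [Set.indicator_of_mem hy, Set.indicator_of_mem]
        rwa [Set.mem_preimage, e3]
      · rw [Set.indicator_of_notMem hy, Set.indicator_of_notMem]
        · simp
        · rwa [Set.mem_preimage, e3]
    simp only [e0]
    rw [lintegral_const_mul' _ _ (ENNReal.zpow_lt_top hP.q_ne_zero (ENNReal.natCast_ne_top _) _).ne,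
      hP.lintegral_zpow_mul, ← mul_assoc,
      ← ENNReal.zpow_add hP.q_ne_zero (ENNReal.natCast_ne_top _), add_neg_cancel, zpow_zero,
      one_mul, lintegral_indicator (hP.measurableSet_dilate hWm _)]
  have hFm : AEStronglyMeasurable F μ := (hGm.indicator hWm).const_mul _
  have hF2 : MemLp F 2 μ := by
    refine ⟨hFm, lt_top_iff_ne_top.2 fun htop => ?_⟩
    have h1 := hnorm
    rw [← eLpNorm_two_sq, htop, ENNReal.top_pow two_ne_zero] at h1
    refine ENNReal.pow_ne_top (n := 2) hg.2.1.2.ne (top_le_iff.1 ?_)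
    rw [eLpNorm_two_sq, h1]
    exact setLIntegral_le_lintegral _ _
  have hFW : ∀ x ∉ W, F x = 0 := fun x hx => by simp [hF, hx]
  have hF1 : Integrable F μ := memLp_one_iff_integrable.1 <|
    hF2.mono_exponent_of_measure_support_ne_top (s := W) hFW
      ((hΛ.measure_le_one hP hWm hW).trans_lt ENNReal.one_lt_top).ne (by norm_num)
  rw [hΛ.tsum_enorm_sq_integral hP hW hF1 hF2 hFW, hnorm]

variable {p c : ℕ} {ε : Fin c → K} {L : ℕ}

lemma affine_scale_sq (hq : 1 < p ^ c) (j : ℤ) :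
    ((((p ^ c : ℕ) : ℝ) ^ ((j : ℝ) / 2)) : ℝ) ^ 2 = ((p ^ c : ℕ) : ℝ) ^ j := by
  have h0 : (0 : ℝ) < ((p ^ c : ℕ) : ℝ) := by exact_mod_cast (by omega)
  rw [← Real.rpow_natCast, ← Real.rpow_mul h0.le, ← Real.rpow_intCast]
  congr 1
  push_cast
  ring

/-- For packing pieces, the energy of all frame coefficients of `g` is the energy of `ĝ` on the
dilates of the pieces. -/
theorem tsum_enorm_sq_affine (hΛ : IsDualLattice χ ϖ (u p ϖ ε))
    (hP : IsNormalizedPair μ χ ϖ (p ^ c)) {W : Fin L → Set K} (hWm : ∀ m, MeasurableSet (W m))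
    (hW : ∀ m, Packs μ (u p ϖ ε) (W m)) {f : Fin L → K → ℂ}
    (hf : ∀ m, IsFourierTransform μ χ (f m) ((W m).indicator 1)) {g G : K → ℂ}
    (hg : IsFourierTransform μ χ g G) :
    ∑' i : Fin L × ℤ × ℕ, ‖inner₂ μ g (affine p ϖ ε (f i.1) i.2.1 i.2.2)‖ₑ ^ 2 =
      ∑' i : ℤ × Fin L, ∫⁻ x in dilate ϖ i.1 (W i.2), ‖G x‖ₑ ^ 2 ∂μ := by
  conv_rhs => rw [ENNReal.tsum_prod', ENNReal.tsum_comm]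
  rw [ENNReal.tsum_prod']
  refine tsum_congr fun m => ?_
  rw [ENNReal.tsum_prod']
  rw [← (Equiv.neg ℤ).tsum_eq fun j => ∑' t,
    ‖inner₂ μ g (affine p ϖ ε (f m) j t)‖ₑ ^ 2]
  refine tsum_congr fun j => ?_
  conv_rhs => rw [← neg_neg j]
  exact hΛ.tsum_enorm_sq_inner₂ hP (hWm m) (hW m) (hf m) hg (affine_scale_sq hP.one_lt (-j))

/-- The pieces of a Parseval multiframelet pack: test the frame inequality at scale zero on the
functions with transform `1_A`, `A ⊆ W m`. -/
lemma packs_of_isParsevalMultiframelet (hΛ : IsDualLattice χ ϖ (u p ϖ ε))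
    (hP : IsNormalizedPair μ χ ϖ (p ^ c)) {W : Fin L → Set K} (hWm : ∀ m, MeasurableSet (W m))
    {f : Fin L → K → ℂ} (hf : ∀ m, IsFourierTransform μ χ (f m) ((W m).indicator 1))
    (hfr : IsParsevalMultiframelet μ p ϖ ε f) (m : Fin L) : Packs μ (u p ϖ ε) (W m) := by
  refine hΛ.packs_of_bessel hP (hWm m) fun A hA hAm hAμ => ?_
  have h2 : MemLp (A.indicator (1 : K → ℂ)) 2 μ :=
    memLp_indicator_const 2 hAm 1 (Or.inr hAμ)
  have h1 : MemLp (A.indicator (1 : K → ℂ)) 1 μ :=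
    memLp_indicator_const 1 hAm 1 (Or.inr hAμ)
  obtain ⟨g, hg⟩ := hP.exists_isFourierTransform_eq (memLp_one_iff_integrable.1 h1) h2
  have hsum := (isParsevalMultiframelet_iff.1 hfr).2 g hg.1
  have hnorm : ∫⁻ x, ‖g x‖ₑ ^ 2 ∂μ = μ A := by
    rw [← (eLpNorm_two_eq_iff _ _).1 (hP.eLpNorm_eq hg), ← lintegral_indicator_one hAm]
    congr 1
    ext x
    by_cases hx : x ∈ A <;> simp [hx]
  rw [hnorm] at hsum
  rw [← hsum]
  have hinj : Function.Injective fun t : ℕ => ((m, 0, t) : Fin L × ℤ × ℕ) := fun t t' h => by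
    simpa using h
  refine le_trans (le_of_eq (tsum_congr fun t => ?_)) (ENNReal.tsum_comp_le_tsum_of_injective hinj
    fun i => ‖inner₂ μ g (affine p ϖ ε (f i.1) i.2.1 i.2.2)‖ₑ ^ 2)
  have h := hP.inner₂_affine (hf m) hg (affine_scale_sq hP.one_lt 0) (u p ϖ ε t)
  have h' : inner₂ μ g (affine p ϖ ε (f m) 0 t) = _ := h
  simp only [h']
  congr 2
  rw [← integral_indicator hAm]
  congr 1
  ext x
  by_cases hx : x ∈ A
  · simp [hx, hA hx]
  · by_cases hx' : x ∈ W m <;> simp [hx, hx']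

end Framelet

/-- A countable family of measurable sets is a partition up to null sets as soon as it cuts every
set of finite measure into parts of the right total measure. -/
lemma isAEPartition_of_tsum {α ι : Type*} [Field α] [MeasurableSpace α] [Countable ι]
    {μ : Measure α} [SigmaFinite μ] {S : ι → Set α} (hS : ∀ i, MeasurableSet (S i))
    (h : ∀ B, MeasurableSet B → μ B ≠ ⊤ → ∑' i, μ (S i ∩ B) = μ B) : IsAEPartition μ S := by
  classical
  have hnull : ∀ A, MeasurableSet A →
      (∀ B, B ⊆ A → MeasurableSet B → μ B ≠ ⊤ → μ B = 0) → μ A = 0 := by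
    intro A hA hB
    rw [← Set.inter_univ A, ← iUnion_spanningSets μ, Set.inter_iUnion]
    refine measure_iUnion_null fun n => hB _ Set.inter_subset_left
      (hA.inter (measurableSet_spanningSets μ n)) ?_
    exact ((measure_mono Set.inter_subset_right).trans_lt (measure_spanningSets_lt_top μ n)).ne
  refine ⟨hS, fun i i' hii' => hnull _ ((hS i).inter (hS i')) fun B hB hBm hBμ => ?_,
    hnull _ (MeasurableSet.iUnion hS).compl fun B hB hBm hBμ => ?_⟩
  · have h1 := h B hBm hBμ
    have h2 : ∑ k ∈ ({i, i'} : Finset ι), μ (S k ∩ B) ≤ ∑' k, μ (S k ∩ B) := ENNReal.sum_le_tsum _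
    rw [Finset.sum_pair hii', h1, Set.inter_eq_right.2 (hB.trans Set.inter_subset_left),
      Set.inter_eq_right.2 (hB.trans Set.inter_subset_right)] at h2
    have h3 : μ B + μ B ≤ μ B + 0 := by simpa using h2
    exact le_antisymm ((ENNReal.add_le_add_iff_left hBμ).1 h3) zero_le
  · rw [← h B hBm hBμ, ENNReal.tsum_eq_zero]
    intro i
    have : S i ∩ B = ∅ := by
      refine Set.eq_empty_iff_forall_notMem.2 fun x hx => ?_
      exact hB hx.2 (Set.mem_iUnion.2 ⟨i, hx.1⟩)
    rw [this, measure_empty]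

section Main

variable {K : Type*} [Field K] [ValuativeRel K] [TopologicalSpace K]
  [IsNonarchimedeanLocalField K] [MeasurableSpace K] [BorelSpace K] [SecondCountableTopology K]
  {μ : Measure K} [μ.IsAddHaarMeasure] {χ : AddChar K Circle} {ϖ : K}
  {p c : ℕ} {ε : Fin c → K} {L : ℕ}

theorem generatesParseval_iff (hΛ : IsDualLattice χ ϖ (u p ϖ ε))
    (hP : IsNormalizedPair μ χ ϖ (p ^ c)) (W : Fin L → Set K) :
    GeneratesParseval μ χ p ϖ ε W ↔
      DilatesPartition μ ϖ W ∧ TranslatesDisjoint μ p ϖ ε W := by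
  rw [translatesDisjoint_iff hP]
  constructor
  · rintro ⟨hWm, f, hf, hfr⟩
    have hW := packs_of_isParsevalMultiframelet hΛ hP hWm hf hfr
    refine ⟨isAEPartition_of_tsum (fun i => hP.measurableSet_dilate (hWm i.2) i.1)
      fun B hBm hBμ => ?_, hW⟩
    have h2 : MemLp (B.indicator (1 : K → ℂ)) 2 μ :=
      memLp_indicator_const 2 hBm 1 (Or.inr hBμ)
    have h1 : MemLp (B.indicator (1 : K → ℂ)) 1 μ :=
      memLp_indicator_const 1 hBm 1 (Or.inr hBμ)
    obtain ⟨g, hg⟩ := hP.exists_isFourierTransform_eq (memLp_one_iff_integrable.1 h1) h2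
    have hsum := (isParsevalMultiframelet_iff.1 hfr).2 g hg.1
    have hB : ∀ x, ‖B.indicator (1 : K → ℂ) x‖ₑ ^ 2 = B.indicator 1 x := fun x => by
      by_cases hx : x ∈ B <;> simp [hx]
    rw [tsum_enorm_sq_affine hΛ hP hWm hW hf hg,
      ← (eLpNorm_two_eq_iff _ _).1 (hP.eLpNorm_eq hg)] at hsum
    simp only [hB, lintegral_indicator_one hBm, Measure.restrict_apply hBm] at hsum
    simpa only [Set.inter_comm B] using hsum
  · rintro ⟨hpart, hW⟩
    have hWm : ∀ m, MeasurableSet (W m) := fun m => by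
      simpa only [dilate_zero] using hpart.1 (0, m)
    have hWμ : ∀ m, μ (W m) ≠ ⊤ := fun m =>
      ((hΛ.measure_le_one hP (hWm m) (hW m)).trans_lt ENNReal.one_lt_top).ne
    have hex : ∀ m, ∃ f, IsFourierTransform μ χ f ((W m).indicator 1) := fun m =>
      hP.exists_isFourierTransform_eq
        (memLp_one_iff_integrable.1 (memLp_indicator_const 1 (hWm m) 1 (Or.inr (hWμ m))))
        (memLp_indicator_const 2 (hWm m) 1 (Or.inr (hWμ m)))
    choose f hf using hex
    refine ⟨hWm, f, hf, isParsevalMultiframelet_iff.2 ⟨fun m => (hf m).1, fun g hg => ?_⟩⟩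
    obtain ⟨G, hG⟩ := hP.exists_isFourierTransform hg
    rw [tsum_enorm_sq_affine hΛ hP hWm hW hf hG, ← (eLpNorm_two_eq_iff _ _).1 (hP.eLpNorm_eq hG),
      ← lintegral_iUnion₀ (fun i => (hpart.1 i).nullMeasurableSet) hpart.2.1,
      Measure.restrict_congr_set (ae_eq_univ.2 hpart.2.2), Measure.restrict_univ]

end Main

end LocalFieldFramelet

open LocalFieldFramelet in
theorem mainTheorem1 {K : Type*} [Field K] [ValuativeRel K] [TopologicalSpace K]
    [IsNonarchimedeanLocalField K] [MeasurableSpace K] [BorelSpace K]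
    (μ : Measure K) [μ.IsAddHaarMeasure] (hμ : μ {x : K | valuation K x ≤ 1} = 1)
    (p c : ℕ) [Fact p.Prime] [CharP K p] [NeZero c]
    (hq : Nat.card (IsLocalRing.ResidueField (valuation K).integer) = p ^ c)
    (ϖ : K) (hϖ : IsPrimeElement ϖ)
    (ε : Fin c → K) (hε : IsConstantBasis p c ε)
    (χ : AddChar K Circle) (hχ : IsStandardCharacter p ϖ ε χ) (L : ℕ) :
    (∀ W : Fin L → Set K,
      GeneratesParseval μ χ p ϖ ε W ↔
        DilatesPartition μ ϖ W ∧ TranslatesDisjoint μ p ϖ ε W) ∧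
    (∀ P : Set K,
      IsParsevalMultiframeletSet μ χ p ϖ ε L P ↔
        ∃ W : Fin L → Set K, P = ⋃ m, W m ∧
          DilatesPartition μ ϖ W ∧ TranslatesDisjoint μ p ϖ ε W) := by
  have := hϖ.secondCountableTopology
  have h := generatesParseval_iff (L := L) (hε.isDualLattice hϖ hq hχ)
    (hε.isNormalizedPair μ hμ hϖ hq hχ)
  exact ⟨h, fun P => exists_congr fun W => and_congr_right fun _ => h W⟩
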